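/- Let $n\ge 1$ and equip $\mathbb R^{n+1}=\{(t,x): t\in\mathbb R,\ x\in\mathbb R^n\}$ with the Minkowski metric $g=-dt^2+dx_1^2+\dots+dx_n^2$, so that $\Box=-\partial_t^2+\sum_{i=1}^n\partial_{x_i}^2$. Put $r=|x|$, $u=\tfrac12(t-r)$, $v=\tfrac12(t+r)$, and let $$\mathcal D=\{(t,x)\in\mathbb R^{n+1}: |t|<r\}$$ be the exterior of the double null cone about the origin. Let $\partial_u=\partial_t-\partial_r$ and $\partial_v=\partial_t+\partial_r$ be the derivatives in the coordinates $(u,v,\omega)$, $\omega=x/r$, and let $|\nabla\!\!\!\!/\,\phi|$ be the length of the gradient of $\phi$ along the spheres of constant $(t,r)$, that is, of the part of $\nabla_x\phi$ orthogonal to $x$. There is a universal constant $B>0$ (depending on none of the data below, in particular not on $n$, $\beta$, $p$) with the following property. Let $n\ge1$, let $0<p<\beta$, let $\phi\in C^2(\mathcal D)$ and $\mathcal V\in C^0(\mathcal D)$ be real-valued, and suppose that $$|\Box\phi|\le|\mathcal V|\,|\phi|\quad\text{on }\mathcal D,$$ that $\phi$ satisfies the decay conditions $$\sup_{\mathcal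 D}\ [(1+|u|)(1+|v|)]^{\frac{n-1+\beta}{2}}\bigl(|u\,\partial_u\phi|+|v\,\partial_v\phi|\bigr)<\infty,$$ $$\sup_{\mathcal D\cap\{|uv|<1\}}\ [(1+|u|)(1+|v|)]^{\frac{n-1+\beta}{2}}\,|uv|^{\frac12}\,|\nabla\!\!\!\!/\,\phi|<\infty,$$ $$\sup_{\mathcal D}\ [(1+|u|)(1+|v|)]^{\frac{n-1+\beta}{2}}\,|\phi|<\infty,$$ and that $$|\mathcal V|\le B\,p\,\min(\beta-p,\,p)\,\min\bigl(|uv|^{-1+\frac p2},\,|uv|^{-1-\frac p2}\bigr)\quad\text{on }\mathcal D.$$ Then $\phi$ vanishes everywhere on $\mathcal D$. -/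

import Mathlib

noncomputable section

namespace ExteriorWave

/-- The spacetime `ℝ^{n+1}`, with points `z = (t, x)`, `t` the time and `x` the Euclidean space
variable. The Minkowski metric `g = -dt² + dx₁² + ⋯ + dxₙ²` enters through `box` below. -/
abbrev Spacetime (n : ℕ) : Type := ℝ × EuclideanSpace ℝ (Fin n)

variable {n : ℕ}

/-- The radius `r = |x|`. -/
def rad (z : Spacetime n) : ℝ := ‖z.2‖

/-- The null coordinate `u = (t - r) / 2`. -/
def nullU (z : Spacetime n) : ℝ := (z.1 - rad z) / 2

/-- The null coordinate `v = (t + r) / 2`. -/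
def nullV (z : Spacetime n) : ℝ := (z.1 + rad z) / 2

/-- The exterior `{|t| < r}` of the double null cone about the origin. -/
def exterior (n : ℕ) : Set (Spacetime n) := {z | |z.1| < rad z}

/-- The time direction. -/
def timeDir (n : ℕ) : Spacetime n := (1, 0)

/-- The `i`-th Cartesian space direction. -/
def spaceDir (i : Fin n) : Spacetime n := (0, EuclideanSpace.single i 1)

/-- The derivative of `φ` at `z` in the direction `w`. -/
def dirDeriv (w : Spacetime n) (φ : Spacetime n → ℝ) (z : Spacetime n) : ℝ := fderiv ℝ φ z w

/-- The wave operator `□ φ = -∂ₜ² φ + ∑ᵢ ∂ᵢ² φ` of the Minkowski metric. -/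
def box (φ : Spacetime n → ℝ) (z : Spacetime n) : ℝ :=
  -dirDeriv (timeDir n) (dirDeriv (timeDir n) φ) z
    + ∑ i : Fin n, dirDeriv (spaceDir i) (dirDeriv (spaceDir i) φ) z

/-- The outward radial unit vector `x / |x|`. -/
def radialUnit (z : Spacetime n) : EuclideanSpace ℝ (Fin n) := (rad z)⁻¹ • z.2

/-- `∂_u φ` in the null coordinates `(u, v, ω)`: since `t = u + v` and `r = v - u`, the coordinate
vector field is `∂_u = ∂_t - ∂_r`. -/
def partialU (φ : Spacetime n → ℝ) (z : Spacetime n) : ℝ := dirDeriv (1, -radialUnit z) φ z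

/-- `∂_v φ` in the null coordinates `(u, v, ω)`: the coordinate vector field is
`∂_v = ∂_t + ∂_r`. -/
def partialV (φ : Spacetime n → ℝ) (z : Spacetime n) : ℝ := dirDeriv (1, radialUnit z) φ z

/-- The Euclidean gradient `∇ₓ φ` in the space variables. -/
def spaceGrad (φ : Spacetime n → ℝ) (z : Spacetime n) : EuclideanSpace ℝ (Fin n) :=
  WithLp.toLp 2 fun i => dirDeriv (spaceDir i) φ z

/-- The gradient of `φ` along the sphere of constant `(t, r)` through `z`: the part of the space
gradient which is tangent to that sphere. -/
def sphGrad (φ : Spacetime n → ℝ) (z : Spacetime n) : EuclideanSpace ℝ (Fin n) :=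
  spaceGrad φ z - inner ℝ (radialUnit z) (spaceGrad φ z) • radialUnit z

/-- The weight `((1 + |u|)(1 + |v|))^((n - 1 + β) / 2)`. -/
def decayWeight (β : ℝ) (z : Spacetime n) : ℝ :=
  ((1 + |nullU z|) * (1 + |nullV z|)) ^ (((n : ℝ) - 1 + β) / 2)

/-- The three decay conditions on `φ` and its first derivatives: the suprema are finite. -/
structure Decays (β : ℝ) (φ : Spacetime n → ℝ) : Prop where
  null_derivatives : BddAbove ((fun z => decayWeight β z *
    (|nullU z * partialU φ z| + |nullV z * partialV φ z|)) '' exterior n)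
  sph_derivatives : BddAbove ((fun z => decayWeight β z *
    (|nullU z * nullV z| ^ (1 / 2 : ℝ) * ‖sphGrad φ z‖)) ''
      (exterior n ∩ {z | |nullU z * nullV z| < 1}))
  function : BddAbove ((fun z => decayWeight β z * |φ z|) '' exterior n)

end ExteriorWave

end

noncomputable section

namespace ExteriorWave

open Real Set Filter Topology MeasureTheory
open scoped ENNReal

/-! ### Flat-space calculus: the wave operator, Minkowski gradients, and the functions `hyp` and
`radSq` -/

section Calculus

variable {n : ℕ}

/-! ### Directional derivatives -/

/-! Write f = -uv = (r² - t²)/4 (`hyp`), which is positive exactly on the exterior region, let S =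
t∂ₜ + x·∂ₓ be the scaling field, and put X_α φ = Sφ + ((n-1)/2 + α)φ. The gradient of f is S/2, so
f^α X_α φ is a natural multiplier for □φ. An exact divergence identity (`sum_dirDeriv_current`)
leaves only f^α □φ X_α φ plus the positive term (α/2) f^(α-1) (X_α φ)². For functions compactly
supported in the exterior region this gives `carleman_estimate`, with constant 4/α².

The estimate controls only X_α φ. No Hardy inequality is needed to reach φ itself: X_(α+p/2) φ - X_α
φ = (p/2)φ, so adding the estimates for α and α + p/2 bounds φ² pointwise
(`absorbWeight_mul_sq_le`), with the weight f^(α-1) y/(1+y), where y = f^(p/2). The assumed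
two-sided decay of the potential, of the form f⁻¹ min(y, y⁻¹), is what this weight can absorb
(`weighted_sq_le`, `carleman_absorb`).

To apply this, φ is multiplied by cutoffs in f and in r². Their commutators with □ obey a
scale-invariant bound by |φ| + |u∂_uφ| + |v∂_vφ|, uniform in the cutoff parameter
(`abs_hyp_mul_boxCommutator_le`). By the decay conditions the squared errors are dominated by
integrable functions for both exponents (`integrableOn_hyp_rpow_mul_decayWeight`). They also vanish
eventually at each point, so dominated convergence removes them, and the weighted integral of φ² is
zero. Finite-order decay therefore suffices; no vanishing of infinite order is required. -/

lemma dirDeriv_add {φ ψ : Spacetime n → ℝ} {z : Spacetime n} (w : Spacetime n)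
    (hφ : DifferentiableAt ℝ φ z) (hψ : DifferentiableAt ℝ ψ z) :
    dirDeriv w (fun y => φ y + ψ y) z = dirDeriv w φ z + dirDeriv w ψ z := by
  simp [dirDeriv, fderiv_fun_add hφ hψ]

lemma dirDeriv_sub {φ ψ : Spacetime n → ℝ} {z : Spacetime n} (w : Spacetime n)
    (hφ : DifferentiableAt ℝ φ z) (hψ : DifferentiableAt ℝ ψ z) :
    dirDeriv w (fun y => φ y - ψ y) z = dirDeriv w φ z - dirDeriv w ψ z := by
  simp [dirDeriv, fderiv_fun_sub hφ hψ]

lemma dirDeriv_mul {φ ψ : Spacetime n → ℝ} {z : Spacetime n} (w : Spacetime n)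
    (hφ : DifferentiableAt ℝ φ z) (hψ : DifferentiableAt ℝ ψ z) :
    dirDeriv w (fun y => φ y * ψ y) z = φ z * dirDeriv w ψ z + ψ z * dirDeriv w φ z := by
  simp [dirDeriv, fderiv_fun_mul hφ hψ]

lemma dirDeriv_const_mul {φ : Spacetime n → ℝ} {z : Spacetime n} (w : Spacetime n) (c : ℝ)
    (hφ : DifferentiableAt ℝ φ z) :
    dirDeriv w (fun y => c * φ y) z = c * dirDeriv w φ z := by
  simp [dirDeriv, fderiv_const_mul hφ]

lemma dirDeriv_sum {ι : Type*} (s : Finset ι) {φ : ι → Spacetime n → ℝ} {z : Spacetime n}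
    (w : Spacetime n) (hφ : ∀ i ∈ s, DifferentiableAt ℝ (φ i) z) :
    dirDeriv w (fun y => ∑ i ∈ s, φ i y) z = ∑ i ∈ s, dirDeriv w (φ i) z := by
  simp [dirDeriv, fderiv_fun_sum hφ]

lemma dirDeriv_comp {a : ℝ → ℝ} {g : Spacetime n → ℝ} {z : Spacetime n} {a' : ℝ} (w : Spacetime n)
    (ha : HasDerivAt a a' (g z)) (hg : DifferentiableAt ℝ g z) :
    dirDeriv w (fun y => a (g y)) z = a' * dirDeriv w g z := by
  have := (ha.comp_hasFDerivAt z hg.hasFDerivAt).fderiv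
  simp only [Function.comp_def] at this
  simp [dirDeriv, this]

lemma dirDeriv_congr {φ ψ : Spacetime n → ℝ} {z : Spacetime n} (w : Spacetime n)
    (h : φ =ᶠ[𝓝 z] ψ) : dirDeriv w φ z = dirDeriv w ψ z := by
  simp [dirDeriv, h.fderiv_eq]

lemma contDiffAt_dirDeriv {φ : Spacetime n → ℝ} {z : Spacetime n} (w : Spacetime n)
    (hφ : ContDiffAt ℝ 2 φ z) : ContDiffAt ℝ 1 (dirDeriv w φ) z :=
  (hφ.fderiv_right (m := 1) (by norm_num)).clm_apply contDiffAt_const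

lemma dirDeriv_comm {φ : Spacetime n → ℝ} {z : Spacetime n} (v w : Spacetime n)
    (hφ : ContDiffAt ℝ 2 φ z) :
    dirDeriv v (dirDeriv w φ) z = dirDeriv w (dirDeriv v φ) z := by
  have hd : DifferentiableAt ℝ (fderiv ℝ φ) z :=
    (hφ.fderiv_right (m := 1) (by norm_num)).differentiableAt (by norm_num)
  have key : ∀ a b : Spacetime n, dirDeriv a (dirDeriv b φ) z = fderiv ℝ (fderiv ℝ φ) z a b := by
    intro a b
    have := fderiv_clm_apply hd (differentiableAt_const b)
    simp only [dirDeriv] at *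
    change fderiv ℝ (fun y => fderiv ℝ φ y b) z a = _
    rw [this]
    simp
  rw [key, key]
  exact (hφ.isSymmSndFDerivAt (by simp)).eq v w

/-! ### Cartesian coordinates -/

/-- The Cartesian basis vectors, with `none` for the time direction. -/
def dir (μ : Option (Fin n)) : Spacetime n := μ.elim (timeDir n) spaceDir

/-- The diagonal entries of the Minkowski metric. -/
def sgn (μ : Option (Fin n)) : ℝ := μ.elim (-1) fun _ => 1

/-- The Cartesian coordinates of a point. -/
def coord (μ : Option (Fin n)) (z : Spacetime n) : ℝ := μ.elim z.1 fun i => z.2 i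

lemma sgn_mul_self (μ : Option (Fin n)) : sgn μ * sgn μ = 1 := by
  cases μ <;> simp [sgn]

lemma contDiff_coord (μ : Option (Fin n)) : ContDiff ℝ 2 (coord μ : Spacetime n → ℝ) := by
  cases μ with
  | none => exact contDiff_fst
  | some i =>
    change ContDiff ℝ 2 (fun z : Spacetime n => (EuclideanSpace.proj i : _ →L[ℝ] ℝ) z.2)
    exact (ContinuousLinearMap.contDiff _).comp contDiff_snd

lemma differentiableAt_coord (μ : Option (Fin n)) (z : Spacetime n) :
    DifferentiableAt ℝ (coord μ : Spacetime n → ℝ) z :=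
  (contDiff_coord μ).contDiffAt.differentiableAt (by norm_num)

lemma dirDeriv_coord (μ : Option (Fin n)) (w z : Spacetime n) :
    dirDeriv w (coord μ) z = coord μ w := by
  cases μ with
  | none =>
    change fderiv ℝ (fun z : Spacetime n => (ContinuousLinearMap.fst ℝ ℝ _) z) z w = _
    rw [ContinuousLinearMap.fderiv]; rfl
  | some i =>
    change fderiv ℝ (fun z : Spacetime n => ((EuclideanSpace.proj i : _ →L[ℝ] ℝ).comp
      (ContinuousLinearMap.snd ℝ ℝ _)) z) z w = _
    rw [ContinuousLinearMap.fderiv]; rfl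

lemma coord_dir (μ ν : Option (Fin n)) : coord μ (dir ν) = if μ = ν then 1 else 0 := by
  cases μ <;> cases ν <;> simp [coord, dir, timeDir, spaceDir, eq_comm]

lemma sum_coord_smul_dir (w : Spacetime n) : ∑ μ, coord μ w • dir μ = w := by
  rw [Fintype.sum_option]
  refine Prod.ext ?_ ?_
  · simp [coord, dir, timeDir, spaceDir, Prod.fst_sum]
  · ext j
    simp [coord, dir, timeDir, spaceDir, Prod.snd_sum, Finset.sum_apply, Pi.single_apply]

lemma dirDeriv_eq_sum (w : Spacetime n) (φ : Spacetime n → ℝ) (z : Spacetime n) :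
    dirDeriv w φ z = ∑ μ, coord μ w * dirDeriv (dir μ) φ z := by
  conv_lhs => rw [← sum_coord_smul_dir w]
  simp [dirDeriv, map_sum]

lemma box_eq_sum (φ : Spacetime n → ℝ) (z : Spacetime n) :
    box φ z = ∑ μ, sgn μ * dirDeriv (dir μ) (dirDeriv (dir μ) φ) z := by
  rw [Fintype.sum_option]
  simp [box, sgn, dir]

/-- The Minkowski inner product of two gradients. -/
def gradInner (φ ψ : Spacetime n → ℝ) (z : Spacetime n) : ℝ :=
  ∑ μ, sgn μ * dirDeriv (dir μ) φ z * dirDeriv (dir μ) ψ z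

/-- The derivative along the scaling vector field. -/
def scaling (φ : Spacetime n → ℝ) (z : Spacetime n) : ℝ := dirDeriv z φ z

lemma scaling_eq_sum (φ : Spacetime n → ℝ) (z : Spacetime n) :
    scaling φ z = ∑ μ, coord μ z * dirDeriv (dir μ) φ z := dirDeriv_eq_sum z φ z

lemma box_mul {φ ψ : Spacetime n → ℝ} {z : Spacetime n} (hφ : ContDiffAt ℝ 2 φ z)
    (hψ : ContDiffAt ℝ 2 ψ z) :
    box (fun y => φ y * ψ y) z = φ z * box ψ z + ψ z * box φ z + 2 * gradInner φ ψ z := by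
  simp only [box_eq_sum, gradInner, Finset.mul_sum, ← Finset.sum_add_distrib]
  refine Finset.sum_congr rfl fun μ _ => ?_
  have e : dirDeriv (dir μ) (fun y => φ y * ψ y) =ᶠ[𝓝 z]
      fun y => φ y * dirDeriv (dir μ) ψ y + ψ y * dirDeriv (dir μ) φ y := by
    filter_upwards [hφ.eventually (by simp), hψ.eventually (by simp)] with y h1 h2
    exact dirDeriv_mul _ (h1.differentiableAt (by norm_num)) (h2.differentiableAt (by norm_num))
  have d1 := hφ.differentiableAt (by norm_num)
  have d2 := hψ.differentiableAt (by norm_num)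
  have d3 := (contDiffAt_dirDeriv (dir μ) hφ).differentiableAt (by norm_num)
  have d4 := (contDiffAt_dirDeriv (dir μ) hψ).differentiableAt (by norm_num)
  rw [dirDeriv_congr _ e, dirDeriv_add _ (d1.fun_mul d4) (d2.fun_mul d3), dirDeriv_mul _ d1 d4,
    dirDeriv_mul _ d2 d3]
  ring

lemma box_comp {a a' : ℝ → ℝ} {a'' : ℝ} {g : Spacetime n → ℝ} {z : Spacetime n}
    (ha : ∀ y, HasDerivAt a (a' y) y) (ha' : HasDerivAt a' a'' (g z)) (hg : ContDiffAt ℝ 2 g z) :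
    box (fun y => a (g y)) z = a'' * gradInner g g z + a' (g z) * box g z := by
  simp only [box_eq_sum, gradInner, Finset.mul_sum, ← Finset.sum_add_distrib]
  refine Finset.sum_congr rfl fun μ _ => ?_
  have e : dirDeriv (dir μ) (fun y => a (g y)) =ᶠ[𝓝 z]
      fun y => a' (g y) * dirDeriv (dir μ) g y := by
    filter_upwards [hg.eventually (by simp)] with y h1
    exact dirDeriv_comp _ (ha _) (h1.differentiableAt (by norm_num))
  have d1 := hg.differentiableAt (by norm_num)
  have d3 := (contDiffAt_dirDeriv (dir μ) hg).differentiableAt (by norm_num)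
  have d2 : DifferentiableAt ℝ (fun y => a' (g y)) z := ha'.differentiableAt.comp z d1
  rw [dirDeriv_congr _ e, dirDeriv_mul _ d2 d3,
    dirDeriv_comp _ ha' d1]
  ring

lemma gradInner_comp_left {a : ℝ → ℝ} {a' : ℝ} {g φ : Spacetime n → ℝ} {z : Spacetime n}
    (ha : HasDerivAt a a' (g z)) (hg : DifferentiableAt ℝ g z) :
    gradInner (fun y => a (g y)) φ z = a' * gradInner g φ z := by
  simp only [gradInner, Finset.mul_sum, dirDeriv_comp _ ha hg]
  exact Finset.sum_congr rfl fun μ _ => by ring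

lemma gradInner_comm (φ ψ : Spacetime n → ℝ) (z : Spacetime n) :
    gradInner φ ψ z = gradInner ψ φ z :=
  Finset.sum_congr rfl fun μ _ => by ring

lemma gradInner_mul_left {φ ψ χ : Spacetime n → ℝ} {z : Spacetime n}
    (hφ : DifferentiableAt ℝ φ z) (hψ : DifferentiableAt ℝ ψ z) :
    gradInner (fun y => φ y * ψ y) χ z = φ z * gradInner ψ χ z + ψ z * gradInner φ χ z := by
  simp only [gradInner, Finset.mul_sum, dirDeriv_mul _ hφ hψ, ← Finset.sum_add_distrib]
  exact Finset.sum_congr rfl fun μ _ => by ring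

/-! ### The hyperbolic square distance and the square radius -/

/-- A quarter of the Minkowski square distance to the origin, which is `-uv`. -/
def hyp (z : Spacetime n) : ℝ := (‖z.2‖ ^ 2 - z.1 ^ 2) / 4

/-- The square of the radius. -/
def radSq (z : Spacetime n) : ℝ := ‖z.2‖ ^ 2

lemma radSq_eq_sum (z : Spacetime n) : radSq z = ∑ i : Fin n, z.2 i ^ 2 := by
  simp [radSq, EuclideanSpace.norm_sq_eq]

lemma four_mul_hyp (z : Spacetime n) : 4 * hyp z = ∑ μ, sgn μ * coord μ z * coord μ z := by
  rw [Fintype.sum_option]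
  have := radSq_eq_sum z
  simp only [radSq] at this
  simp only [hyp, this, sgn, coord, Option.elim]
  simp [pow_two]
  ring

lemma contDiff_radSq : ContDiff ℝ 2 (radSq : Spacetime n → ℝ) :=
  (contDiff_norm_sq ℝ).comp contDiff_snd

lemma contDiff_hyp : ContDiff ℝ 2 (hyp : Spacetime n → ℝ) :=
  ((contDiff_radSq.sub (contDiff_fst.pow 2)).div_const 4)

lemma dirDeriv_radSq (w z : Spacetime n) : dirDeriv w radSq z = 2 * inner ℝ z.2 w.2 := by
  have h := (hasStrictFDerivAt_norm_sq z.2).hasFDerivAt.comp z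
    (hasFDerivAt_snd (𝕜 := ℝ) (p := z))
  have h2 : fderiv ℝ (radSq : Spacetime n → ℝ) z = _ := h.fderiv
  simp [dirDeriv, h2]

lemma dirDeriv_dir_hyp (μ : Option (Fin n)) (z : Spacetime n) :
    dirDeriv (dir μ) hyp z = sgn μ * coord μ z / 2 := by
  have e : (hyp : Spacetime n → ℝ) = fun y => (1/4) * (radSq y - coord none y * coord none y) := by
    ext y; simp [hyp, radSq, coord]; ring
  have d1 := contDiff_radSq.contDiffAt.differentiableAt (x := z) (by norm_num)
  have d2 := differentiableAt_coord none z
  rw [e, dirDeriv_const_mul _ _ (d1.fun_sub (d2.fun_mul d2)), dirDeriv_sub _ d1 (d2.fun_mul d2),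
    dirDeriv_mul _ d2 d2, dirDeriv_coord, dirDeriv_radSq]
  cases μ with
  | none => simp [coord, dir, timeDir, sgn]; ring
  | some i =>
    simp [coord, dir, spaceDir, sgn, EuclideanSpace.inner_single_right]; ring

/-- The gradient of f is half the scaling field. This dictates the multiplier, and it makes cutoffs
in f produce only scaling derivatives. -/
lemma gradInner_hyp (φ : Spacetime n → ℝ) (z : Spacetime n) :
    gradInner hyp φ z = scaling φ z / 2 := by
  rw [gradInner, scaling_eq_sum, Finset.sum_div]
  refine Finset.sum_congr rfl fun μ _ => ?_
  rw [dirDeriv_dir_hyp]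
  linear_combination (coord μ z * dirDeriv (dir μ) φ z / 2) * sgn_mul_self μ

lemma gradInner_radSq (φ : Spacetime n → ℝ) (z : Spacetime n) :
    gradInner radSq φ z = 2 * dirDeriv (0, z.2) φ z := by
  rw [gradInner, dirDeriv_eq_sum, Fintype.sum_option, Fintype.sum_option]
  simp [dirDeriv_radSq, coord, dir, timeDir, spaceDir, sgn, EuclideanSpace.inner_single_right,
    Finset.mul_sum, mul_assoc]

lemma box_hyp (z : Spacetime n) : box hyp z = (n + 1) / 2 := by
  rw [box_eq_sum]
  have : ∀ μ : Option (Fin n), sgn μ * dirDeriv (dir μ) (dirDeriv (dir μ) hyp) z = 1 / 2 := by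
    intro μ
    have e : dirDeriv (dir μ) hyp = fun y => (sgn μ / 2) * coord μ y := by
      ext y; rw [dirDeriv_dir_hyp]; ring
    rw [e, dirDeriv_const_mul _ _ (differentiableAt_coord _ _), dirDeriv_coord, coord_dir, if_pos rfl]
    linear_combination (1/2) * sgn_mul_self μ
  simp [this]
  ring

lemma box_radSq (z : Spacetime n) : box radSq z = 2 * n := by
  rw [box_eq_sum, Fintype.sum_option]
  have h0 : dirDeriv (dir none) (radSq : Spacetime n → ℝ) = fun _ => 0 := by
    ext y; simp [dirDeriv_radSq, dir, timeDir]
  have h1 : ∀ i : Fin n, dirDeriv (dir (some i)) (radSq : Spacetime n → ℝ)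
      = fun y => 2 * coord (some i) y := by
    intro i; ext y
    simp [dirDeriv_radSq, dir, spaceDir, coord, EuclideanSpace.inner_single_right]
  have h2 : ∀ i : Fin n, dirDeriv (dir (some i)) (fun y => 2 * coord (some i) y) z = 2 := by
    intro i
    rw [dirDeriv_const_mul _ _ (differentiableAt_coord _ _), dirDeriv_coord, coord_dir, if_pos rfl]
    ring
  rw [h0]
  simp only [h1, h2]
  simp [dirDeriv, sgn]
  ring

end Calculus

/-! ### Divergence identity and Carleman estimate with weight `hyp ^ α` -/

section Carleman

variable {n : ℕ}

/-! ### The Carleman identity -/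

lemma dirDeriv_scaling {φ : Spacetime n → ℝ} {z : Spacetime n} (μ : Option (Fin n))
    (hφ : ContDiffAt ℝ 2 φ z) :
    dirDeriv (dir μ) (scaling φ) z = dirDeriv (dir μ) φ z
      + ∑ ν, coord ν z * dirDeriv (dir μ) (dirDeriv (dir ν) φ) z := by
  have e : scaling φ = fun y => ∑ ν, coord ν y * dirDeriv (dir ν) φ y := by
    ext y; exact scaling_eq_sum φ y
  have d := fun ν => (contDiffAt_dirDeriv (dir ν) hφ).differentiableAt (by norm_num)
  rw [e, dirDeriv_sum _ _ fun ν _ => (differentiableAt_coord ν z).fun_mul (d ν)]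
  simp only [dirDeriv_mul _ (differentiableAt_coord _ z) (d _), dirDeriv_coord, coord_dir,
    Finset.sum_add_distrib]
  simp [add_comm]

lemma contDiffAt_scaling {φ : Spacetime n → ℝ} {z : Spacetime n}
    (hφ : ContDiffAt ℝ 2 φ z) : ContDiffAt ℝ 1 (scaling φ) z :=
  (hφ.fderiv_right (m := 1) (by norm_num)).clm_apply contDiffAt_id

lemma contDiffAt_gradInner {φ ψ : Spacetime n → ℝ} {z : Spacetime n}
    (hφ : ContDiffAt ℝ 2 φ z) (hψ : ContDiffAt ℝ 2 ψ z) : ContDiffAt ℝ 1 (gradInner φ ψ) z := by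
  unfold gradInner
  exact ContDiffAt.sum fun μ _ =>
    (contDiffAt_const.mul (contDiffAt_dirDeriv _ hφ)).mul (contDiffAt_dirDeriv _ hψ)

lemma dirDeriv_gradInner_self {φ : Spacetime n → ℝ} {z : Spacetime n} (w : Spacetime n)
    (hφ : ContDiffAt ℝ 2 φ z) :
    dirDeriv w (gradInner φ φ) z =
      ∑ ν, 2 * (sgn ν * dirDeriv (dir ν) φ z * dirDeriv w (dirDeriv (dir ν) φ) z) := by
  have d := fun ν => (contDiffAt_dirDeriv (dir ν) hφ).differentiableAt (by norm_num)
  have e : gradInner φ φ = fun y => ∑ ν, sgn ν * (dirDeriv (dir ν) φ y * dirDeriv (dir ν) φ y) := by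
    ext y; simp [gradInner, mul_assoc]
  rw [e, dirDeriv_sum _ _ fun ν _ => ((d ν).fun_mul (d ν)).const_mul _]
  refine Finset.sum_congr rfl fun ν _ => ?_
  rw [dirDeriv_const_mul _ _ ((d ν).fun_mul (d ν)), dirDeriv_mul _ (d ν) (d ν)]
  ring

lemma contDiffAt_hyp_rpow {z : Spacetime n} (hz : 0 < hyp z) (α : ℝ) :
    ContDiffAt ℝ 2 (fun y : Spacetime n => hyp y ^ α) z :=
  contDiff_hyp.contDiffAt.rpow_const_of_ne hz.ne'

lemma dirDeriv_hyp_rpow {z : Spacetime n} (hz : 0 < hyp z) (α : ℝ) (μ : Option (Fin n)) :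
    dirDeriv (dir μ) (fun y => hyp y ^ α) z
      = α * hyp z ^ (α - 1) * (sgn μ * coord μ z / 2) := by
  rw [dirDeriv_comp (a := fun y => y ^ α) _ (Real.hasDerivAt_rpow_const (Or.inl hz.ne'))
    (contDiff_hyp.contDiffAt.differentiableAt (by norm_num)), dirDeriv_dir_hyp]

/-- The scaling derivative of `φ`, shifted by the order `(n - 1) / 2 + α`. -/
def shiftedScaling (α : ℝ) (φ : Spacetime n → ℝ) (z : Spacetime n) : ℝ :=
  scaling φ z + (((n : ℝ) - 1) / 2 + α) * φ z

/-- The components of the current in the Carleman identity with weight `hyp ^ α`. -/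
def current (α : ℝ) (φ : Spacetime n → ℝ) (μ : Option (Fin n)) (z : Spacetime n) : ℝ :=
  sgn μ * (dirDeriv (dir μ) φ z * (hyp z ^ α * shiftedScaling α φ z))
    - 1 / 2 * (coord μ z * (hyp z ^ α * gradInner φ φ z))
    + α * (((n : ℝ) - 1) / 2 + α) / 4 * (coord μ z * (hyp z ^ (α - 1) * (φ z * φ z)))

lemma contDiffAt_shiftedScaling {φ : Spacetime n → ℝ} {z : Spacetime n} (α : ℝ)
    (hφ : ContDiffAt ℝ 2 φ z) : ContDiffAt ℝ 1 (shiftedScaling α φ) z :=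
  (contDiffAt_scaling hφ).add (contDiffAt_const.mul (hφ.of_le (by norm_num)))

lemma contDiffAt_current {φ : Spacetime n → ℝ} {z : Spacetime n} (α : ℝ) (μ : Option (Fin n))
    (hφ : ContDiffAt ℝ 2 φ z) (hz : 0 < hyp z) : ContDiffAt ℝ 1 (current α φ μ) z := by
  have h1 := contDiffAt_dirDeriv (dir μ) hφ
  have h2 := (contDiffAt_hyp_rpow hz α).of_le (m := 1) (by norm_num)
  have h3 := (contDiffAt_hyp_rpow hz (α - 1)).of_le (m := 1) (by norm_num)
  have h4 := contDiffAt_shiftedScaling α hφ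
  have h5 := (contDiff_coord μ).contDiffAt.of_le (x := z) (m := 1) (by norm_num)
  have h6 := hφ.of_le (m := 1) (by norm_num)
  exact ((contDiffAt_const.mul (h1.mul (h2.mul h4))).sub
    (contDiffAt_const.mul (h5.mul (h2.mul (contDiffAt_gradInner hφ hφ))))).add
    (contDiffAt_const.mul (h5.mul (h3.mul (h6.mul h6))))

/-- With κ = (n-1)/2 + α, the coefficient of f^α times the gradient square is (1 + κ) - (n+1)/2 - α
= 0, which fixes the shift in `shiftedScaling`. The last term of `current` is chosen so that the
remaining terms in (Sφ)², φSφ and φ² complete to the square of Sφ + κφ; this uses α - 1 + (n+1)/2 =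
κ. -/
lemma sum_dirDeriv_current {φ : Spacetime n → ℝ} {z : Spacetime n} (α : ℝ)
    (hφ : ContDiffAt ℝ 2 φ z) (hz : 0 < hyp z) :
    ∑ μ, dirDeriv (dir μ) (current α φ μ) z =
      hyp z ^ α * box φ z * shiftedScaling α φ z
        + α / 2 * (hyp z ^ (α - 1) * shiftedScaling α φ z ^ 2) := by
  have dφ := hφ.differentiableAt (by norm_num)
  have dP := fun ν => (contDiffAt_dirDeriv (dir ν) hφ).differentiableAt (by norm_num)
  have dS := (contDiffAt_scaling hφ).differentiableAt (by norm_num)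
  have dX := (contDiffAt_shiftedScaling α hφ).differentiableAt (by norm_num)
  have dQ := (contDiffAt_gradInner hφ hφ).differentiableAt (by norm_num)
  have df := fun a => (contDiffAt_hyp_rpow hz a).differentiableAt (by norm_num)
  have dc := fun ν => differentiableAt_coord ν z
  set κ : ℝ := ((n : ℝ) - 1) / 2 + α with hκ
  have e1 : hyp z ^ α = hyp z ^ (α - 1) * hyp z := by
    rw [← Real.rpow_add_one hz.ne']; ring_nf
  have e2 : hyp z ^ (α - 1) = hyp z ^ (α - 1 - 1) * hyp z := by
    rw [← Real.rpow_add_one hz.ne']; ring_nf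
  -- The terms are grouped so that summation over μ turns the leading factors into □φ, Sφ, the
  -- gradient square, zero (the Hessian terms) and 4f.
  have step : ∀ μ, dirDeriv (dir μ) (current α φ μ) z =
      (sgn μ * dirDeriv (dir μ) (dirDeriv (dir μ) φ) z) * (hyp z ^ α * shiftedScaling α φ z)
      + (coord μ z * dirDeriv (dir μ) φ z)
          * (α / 2 * hyp z ^ (α - 1) * shiftedScaling α φ z
              + α * κ / 2 * hyp z ^ (α - 1) * φ z)
      + (sgn μ * dirDeriv (dir μ) φ z * dirDeriv (dir μ) φ z) * ((1 + κ) * hyp z ^ α)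
      + hyp z ^ α * ((∑ ν, sgn μ * dirDeriv (dir μ) φ z
            * (coord ν z * dirDeriv (dir μ) (dirDeriv (dir ν) φ) z))
          - ∑ ν, coord μ z * (sgn ν * dirDeriv (dir ν) φ z
            * dirDeriv (dir μ) (dirDeriv (dir ν) φ) z))
      + (sgn μ * coord μ z * coord μ z) * (- (α / 4) * hyp z ^ (α - 1) * gradInner φ φ z
          + α * κ / 8 * (α - 1) * hyp z ^ (α - 1 - 1) * φ z ^ 2)
      + (- (1 / 2) * hyp z ^ α * gradInner φ φ z + α * κ / 4 * hyp z ^ (α - 1) * φ z ^ 2) := by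
    intro μ
    have hX : dirDeriv (dir μ) (shiftedScaling α φ) z = (1 + κ) * dirDeriv (dir μ) φ z
        + ∑ ν, coord ν z * dirDeriv (dir μ) (dirDeriv (dir ν) φ) z := by
      change dirDeriv (dir μ) (fun y => scaling φ y + κ * φ y) z = _
      rw [dirDeriv_add _ dS (dφ.const_mul κ), dirDeriv_const_mul _ _ dφ, dirDeriv_scaling μ hφ]
      ring
    have g1 := (df α).fun_mul dX
    have g2 := (df α).fun_mul dQ
    have g3 := (df (α - 1)).fun_mul (dφ.fun_mul dφ)
    have t1 := ((dP μ).fun_mul g1).const_mul (sgn μ)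
    have t2 := ((dc μ).fun_mul g2).const_mul (1 / 2)
    have t3 := ((dc μ).fun_mul g3).const_mul (α * κ / 4)
    change dirDeriv (dir μ) (fun y =>
      sgn μ * (dirDeriv (dir μ) φ y * (hyp y ^ α * shiftedScaling α φ y))
      - 1 / 2 * (coord μ y * (hyp y ^ α * gradInner φ φ y))
      + α * κ / 4 * (coord μ y * (hyp y ^ (α - 1) * (φ y * φ y)))) z = _
    rw [dirDeriv_add _ (t1.fun_sub t2) t3, dirDeriv_sub _ t1 t2,
      dirDeriv_const_mul _ _ ((dP μ).fun_mul g1), dirDeriv_const_mul _ _ ((dc μ).fun_mul g2),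
      dirDeriv_const_mul _ _ ((dc μ).fun_mul g3), dirDeriv_mul _ (dP μ) g1,
      dirDeriv_mul _ (dc μ) g2, dirDeriv_mul _ (dc μ) g3, dirDeriv_mul _ (df α) dX,
      dirDeriv_mul _ (df α) dQ, dirDeriv_mul _ (df (α - 1)) (dφ.fun_mul dφ),
      dirDeriv_mul _ dφ dφ, dirDeriv_hyp_rpow hz, dirDeriv_hyp_rpow hz, hX,
      dirDeriv_gradInner_self _ hφ, dirDeriv_coord, coord_dir, if_pos rfl]
    simp only [← Finset.mul_sum]
    linear_combination (α / 2 * hyp z ^ (α - 1) * coord μ z * dirDeriv (dir μ) φ z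
      * shiftedScaling α φ z) * sgn_mul_self μ
  -- The Hessian terms from differentiating Sφ and from differentiating the gradient square cancel
  -- by symmetry of second derivatives.
  have swap : ∑ μ : Option (Fin n), ((∑ ν, sgn μ * dirDeriv (dir μ) φ z
            * (coord ν z * dirDeriv (dir μ) (dirDeriv (dir ν) φ) z))
          - ∑ ν, coord μ z * (sgn ν * dirDeriv (dir ν) φ z
            * dirDeriv (dir μ) (dirDeriv (dir ν) φ) z)) = 0 := by
    rw [Finset.sum_sub_distrib, sub_eq_zero, Finset.sum_comm]
    refine Finset.sum_congr rfl fun μ _ => Finset.sum_congr rfl fun ν _ => ?_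
    rw [dirDeriv_comm (dir ν) (dir μ) hφ]
    ring
  simp only [← Finset.mul_sum] at swap
  simp only [step, Finset.sum_add_distrib, ← Finset.mul_sum, ← Finset.sum_mul, swap]
  rw [← box_eq_sum, ← scaling_eq_sum, ← four_mul_hyp]
  change _ + _ + gradInner φ φ z * _ + _ + _ + _ = _
  simp only [Finset.sum_const, Finset.card_univ, Fintype.card_option, Fintype.card_fin, nsmul_eq_mul]
  push_cast
  have hX : shiftedScaling α φ z = scaling φ z + κ * φ z := rfl
  rw [hX, e1, e2, hκ]
  ring

instance : (volume : Measure (Spacetime n)).IsAddHaarMeasure :=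
  inferInstanceAs ((volume : Measure ℝ).prod
    (volume : Measure (EuclideanSpace ℝ (Fin n)))).IsAddHaarMeasure

lemma integral_dirDeriv_eq_zero {J : Spacetime n → ℝ} (hJ : ContDiff ℝ 1 J)
    (hc : HasCompactSupport J) (w : Spacetime n) : ∫ z, dirDeriv w J z = 0 := by
  have h := integral_mul_fderiv_eq_neg_fderiv_mul_of_integrable (μ := (volume : Measure (Spacetime n)))
    (f := fun _ => (1 : ℝ)) (g := J) (v := w) (by simp) ?_ ?_ (by simp)
    (fun x _ => (hJ.differentiable (by norm_num)) x)
  · simpa [dirDeriv] using h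
  · simp only [one_mul]
    exact ((hJ.continuous_fderiv (by norm_num)).clm_apply
      continuous_const).integrable_of_hasCompactSupport (hc.fderiv_apply (𝕜 := ℝ) w)
  · simpa using hJ.continuous.integrable_of_hasCompactSupport hc

/-- A function which is continuous on an open set containing its compact topological support is
integrable. -/
lemma integrable_of_continuousAt_tsupport {g : Spacetime n → ℝ} {K : Set (Spacetime n)}
    (hK : IsCompact K) (hc : ∀ z ∈ K, ContinuousAt g z) (h0 : ∀ z ∉ K, g z = 0) :
    Integrable g := by
  have h : IntegrableOn g K :=
    ContinuousOn.integrableOn_compact hK fun z hz => (hc z hz).continuousWithinAt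
  refine (integrableOn_iff_integrable_of_support_subset fun z hz => ?_).1 h
  by_contra hK'
  exact hz (h0 z hK')

lemma dirDeriv_eq_zero_of_notMem_tsupport {φ : Spacetime n → ℝ} {z : Spacetime n} (w : Spacetime n)
    (hz : z ∉ tsupport φ) : dirDeriv w φ z = 0 := by
  rw [dirDeriv_congr w (notMem_tsupport_iff_eventuallyEq.1 hz)]
  exact (by simp [dirDeriv] : dirDeriv w (fun _ => (0 : ℝ)) z = 0)

lemma box_eq_zero_of_notMem_tsupport {φ : Spacetime n → ℝ} {z : Spacetime n}
    (hz : z ∉ tsupport φ) : box φ z = 0 := by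
  rw [box_eq_sum]
  refine Finset.sum_eq_zero fun μ _ => ?_
  have : dirDeriv (dir μ) φ =ᶠ[𝓝 z] fun _ => 0 := by
    filter_upwards [(isClosed_tsupport φ).isOpen_compl.mem_nhds hz] with y hy
    exact dirDeriv_eq_zero_of_notMem_tsupport _ hy
  rw [dirDeriv_congr _ this]
  simp [dirDeriv]

lemma continuousAt_box {φ : Spacetime n → ℝ} {z : Spacetime n} (hφ : ContDiffAt ℝ 2 φ z) :
    ContinuousAt (box φ) z := by
  have e : box φ = fun y => ∑ μ, sgn μ * dirDeriv (dir μ) (dirDeriv (dir μ) φ) y := by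
    ext y; exact box_eq_sum φ y
  rw [e]
  refine tendsto_finsetSum _ fun μ _ => tendsto_const_nhds.mul ?_
  exact (((contDiffAt_dirDeriv (dir μ) hφ).fderiv_right (m := 0) (by norm_num)).clm_apply
    contDiffAt_const).continuousAt

/-- Needed because the powers of f, and φ itself, are regular only inside the exterior region, while
integration by parts is applied on the whole space. -/
lemma contDiff_of_contDiffAt_tsupport {φ : Spacetime n → ℝ} {k : WithTop ℕ∞}
    (h : ∀ z ∈ tsupport φ, ContDiffAt ℝ k φ z) : ContDiff ℝ k φ := by
  refine contDiff_iff_contDiffAt.2 fun z => ?_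
  by_cases hz : z ∈ tsupport φ
  · exact h z hz
  · exact contDiffAt_const.congr_of_eventuallyEq (notMem_tsupport_iff_eventuallyEq.1 hz)

lemma tsupport_current_subset (α : ℝ) (φ : Spacetime n → ℝ) (μ : Option (Fin n)) :
    tsupport (current α φ μ) ⊆ tsupport φ := by
  refine closure_minimal (fun z hz => ?_) (isClosed_tsupport φ)
  by_contra h
  refine hz ?_
  simp [current, gradInner, dirDeriv_eq_zero_of_notMem_tsupport _ h, image_eq_zero_of_notMem_tsupport h]

/-- The Carleman estimate for compactly supported functions with the weight `hyp ^ α`. -/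
lemma carleman_estimate {φ : Spacetime n → ℝ} {α : ℝ} (hα : 0 < α) (hφ : ContDiff ℝ 2 φ)
    (hc : HasCompactSupport φ) (hs : ∀ z ∈ tsupport φ, 0 < hyp z) :
    ∫ z, hyp z ^ (α - 1) * shiftedScaling α φ z ^ 2 ≤
      4 / α ^ 2 * ∫ z, hyp z ^ (α + 1) * box φ z ^ 2 := by
  have hzero : ∀ z ∉ tsupport φ, shiftedScaling α φ z = 0 := fun z hz => by
    simp [shiftedScaling, scaling, dirDeriv_eq_zero_of_notMem_tsupport _ hz,
      image_eq_zero_of_notMem_tsupport hz]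
  have cf : ∀ (a : ℝ), ∀ z ∈ tsupport φ, ContinuousAt (fun y : Spacetime n => hyp y ^ a) z :=
    fun a z hz => (contDiffAt_hyp_rpow (hs z hz) a).continuousAt
  have cX : ∀ z, ContinuousAt (shiftedScaling α φ) z :=
    fun z => (contDiffAt_shiftedScaling α hφ.contDiffAt).continuousAt
  have cB : ∀ z, ContinuousAt (box φ) z := fun z => continuousAt_box hφ.contDiffAt
  have i1 : Integrable fun z => hyp z ^ α * box φ z * shiftedScaling α φ z :=
    integrable_of_continuousAt_tsupport hc (fun z hz => ((cf α z hz).mul (cB z)).mul (cX z))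
      fun z hz => by simp [hzero z hz]
  have i2 : Integrable fun z => hyp z ^ (α - 1) * shiftedScaling α φ z ^ 2 :=
    integrable_of_continuousAt_tsupport hc (fun z hz => (cf _ z hz).mul ((cX z).pow 2))
      fun z hz => by simp [hzero z hz]
  have i3 : Integrable fun z => hyp z ^ (α + 1) * box φ z ^ 2 :=
    integrable_of_continuousAt_tsupport hc (fun z hz => (cf _ z hz).mul ((cB z).pow 2))
      fun z hz => by simp [box_eq_zero_of_notMem_tsupport hz]
  have cJ : ∀ μ, ContDiff ℝ 1 (current α φ μ) := fun μ => contDiff_of_contDiffAt_tsupport fun z hz =>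
    contDiffAt_current α μ hφ.contDiffAt (hs z (tsupport_current_subset α φ μ hz))
  have kJ : ∀ μ, HasCompactSupport (current α φ μ) := fun μ =>
    hc.of_isClosed_subset (isClosed_tsupport _) (tsupport_current_subset α φ μ)
  have iJ : ∀ μ, Integrable (dirDeriv (dir μ) (current α φ μ)) := fun μ =>
    (((cJ μ).continuous_fderiv (by norm_num)).clm_apply
      continuous_const).integrable_of_hasCompactSupport ((kJ μ).fderiv_apply (𝕜 := ℝ) (dir μ))
  have hJ : ∫ z, ∑ μ, dirDeriv (dir μ) (current α φ μ) z = 0 := by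
    rw [integral_finsetSum _ fun μ _ => iJ μ]
    exact Finset.sum_eq_zero fun μ _ => integral_dirDeriv_eq_zero (cJ μ) (kJ μ) _
  have hid : ∀ z, ∑ μ, dirDeriv (dir μ) (current α φ μ) z =
      hyp z ^ α * box φ z * shiftedScaling α φ z
        + α / 2 * (hyp z ^ (α - 1) * shiftedScaling α φ z ^ 2) := by
    intro z
    by_cases hz : z ∈ tsupport φ
    · exact sum_dirDeriv_current α hφ.contDiffAt (hs z hz)
    · simp [hzero z hz, dirDeriv_eq_zero_of_notMem_tsupport _
        fun h => hz (tsupport_current_subset α φ _ h)]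
  simp only [hid] at hJ
  rw [integral_add i1 (i2.const_mul _), integral_const_mul] at hJ
  -- Young's inequality, weighted so that half of the positive term, α/4 out of α/2, survives.
  have hle : -∫ z, hyp z ^ α * box φ z * shiftedScaling α φ z ≤
      ∫ z, (α / 4 * (hyp z ^ (α - 1) * shiftedScaling α φ z ^ 2)
        + 1 / α * (hyp z ^ (α + 1) * box φ z ^ 2)) := by
    rw [← integral_neg]
    refine integral_mono i1.neg ((i2.const_mul _).add (i3.const_mul _)) fun z => ?_
    by_cases hz : z ∈ tsupport φ
    · have hp := hs z hz
      have e1 : hyp z ^ α = hyp z ^ (α - 1) * hyp z := by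
        rw [← Real.rpow_add_one hp.ne']; ring_nf
      have e2 : hyp z ^ (α + 1) = hyp z ^ (α - 1) * hyp z ^ 2 := by
        rw [Real.rpow_add_one hp.ne', e1]; ring
      have hnn : 0 ≤ hyp z ^ (α - 1) * (α / 4) *
          (shiftedScaling α φ z + 2 / α * (hyp z * box φ z)) ^ 2 := by positivity
      change -(hyp z ^ α * box φ z * shiftedScaling α φ z) ≤ _
      rw [e1, e2]
      refine sub_nonneg.1 (hnn.trans_eq ?_)
      field_simp
      ring
    · simp [hzero z hz, box_eq_zero_of_notMem_tsupport hz]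
  rw [integral_add (i2.const_mul _) (i3.const_mul _), integral_const_mul, integral_const_mul] at hle
  set I := ∫ z, hyp z ^ (α - 1) * shiftedScaling α φ z ^ 2
  set K := ∫ z, hyp z ^ (α + 1) * box φ z ^ 2
  have h4 : α / 4 * I ≤ 1 / α * K := by linarith
  calc I = 4 / α * (α / 4 * I) := by field_simp
    _ ≤ 4 / α * (1 / α * K) := by gcongr
    _ = 4 / α ^ 2 * K := by field_simp

end Carleman

/-! ### Recovering the zeroth-order term and absorbing the potential -/

section Absorption

variable {n : ℕ}

/-- The weight of the zeroth-order term which is gained from two Carleman estimates with exponents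
`α` and `α + p / 2`. -/
def absorbWeight (α p : ℝ) (z : Spacetime n) : ℝ :=
  hyp z ^ (α - 1) * (hyp z ^ (p / 2) / (1 + hyp z ^ (p / 2)))

/-- With X = X_α φ, the quadratic X² + y(X + pφ/2)² is minimal at X = -(y/(1+y)) pφ/2, with minimum
(p²/4)(y/(1+y))φ². -/
lemma absorbWeight_mul_sq_le {z : Spacetime n} (hz : 0 < hyp z) (α p : ℝ) (φ : Spacetime n → ℝ) :
    p ^ 2 / 4 * (absorbWeight α p z * φ z ^ 2) ≤
      hyp z ^ (α - 1) * shiftedScaling α φ z ^ 2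
        + hyp z ^ (α + p / 2 - 1) * shiftedScaling (α + p / 2) φ z ^ 2 := by
  have e : hyp z ^ (α + p / 2 - 1) = hyp z ^ (α - 1) * hyp z ^ (p / 2) := by
    rw [← Real.rpow_add hz]; ring_nf
  have hX : shiftedScaling (α + p / 2) φ z = shiftedScaling α φ z + p / 2 * φ z := by
    simp only [shiftedScaling]; ring
  have hA : 0 < hyp z ^ (α - 1) := by positivity
  have hy : 0 < hyp z ^ (p / 2) := by positivity
  rw [e, hX, absorbWeight]
  set A := hyp z ^ (α - 1)
  set y := hyp z ^ (p / 2)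
  set X := shiftedScaling α φ z
  have hnn : 0 ≤ A / (1 + y) * (X + y * (X + p / 2 * φ z)) ^ 2 := by positivity
  refine sub_nonneg.1 (hnn.trans_eq ?_)
  field_simp
  ring

lemma one_add_sq_mul_min_sq_le {y : ℝ} (hy : 0 < y) :
    (1 + y) ^ 2 * min y y⁻¹ ^ 2 ≤ 4 * y := by
  rcases le_total y 1 with h | h
  · have h1 : min y y⁻¹ ≤ y := min_le_left _ _
    have h0 : 0 ≤ min y y⁻¹ := by positivity
    calc (1 + y) ^ 2 * min y y⁻¹ ^ 2 ≤ (1 + 1) ^ 2 * y ^ 2 := by gcongr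
      _ ≤ 4 * y := by nlinarith
  · have h1 : min y y⁻¹ ≤ y⁻¹ := min_le_right _ _
    have h0 : 0 ≤ min y y⁻¹ := by positivity
    calc (1 + y) ^ 2 * min y y⁻¹ ^ 2 ≤ (y + y) ^ 2 * y⁻¹ ^ 2 := by gcongr
      _ = 4 := by field_simp; norm_num
      _ ≤ 4 * y := by linarith

/-- The two source weights add up to f^(α-1) f² (1+y). Squaring a potential f⁻¹ min(y, y⁻¹) cancels
f², and (1+y) min(y, y⁻¹)² ≤ 4y/(1+y) returns the weight gained for φ². The term e is reserved for
the commutator error. -/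
lemma weighted_sq_le {z : Spacetime n} (hz : 0 < hyp z) (α p c b w e : ℝ)
    (hb : |b| ≤ c * min (hyp z ^ (-1 + p / 2)) (hyp z ^ (-1 - p / 2)) * |w| + |e|) :
    (hyp z ^ (α + 1) + hyp z ^ (α + p / 2 + 1)) * b ^ 2 ≤
      8 * c ^ 2 * (absorbWeight α p z * w ^ 2)
        + 2 * ((hyp z ^ (α + 1) + hyp z ^ (α + p / 2 + 1)) * e ^ 2) := by
  set f := hyp z
  set y := f ^ (p / 2) with hy
  set A := f ^ (α - 1)
  have hyp' : 0 < y := by positivity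
  have hA : 0 < A := by positivity
  have e1 : f ^ (-1 + p / 2) = f⁻¹ * y := by rw [Real.rpow_add hz, Real.rpow_neg_one]
  have e2 : f ^ (-1 - p / 2) = f⁻¹ * y⁻¹ := by
    rw [sub_eq_add_neg, Real.rpow_add hz, Real.rpow_neg_one, Real.rpow_neg hz.le]
  have e3 : f ^ (α + 1) = A * f ^ 2 := by
    rw [← Real.rpow_natCast f 2, ← Real.rpow_add hz]; norm_num; ring_nf
  have e4 : f ^ (α + p / 2 + 1) = A * f ^ 2 * y := by
    rw [← e3, ← Real.rpow_add hz]; ring_nf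
  have hm : min (f ^ (-1 + p / 2)) (f ^ (-1 - p / 2)) = f⁻¹ * min y y⁻¹ := by
    rw [e1, e2, mul_min_of_nonneg _ _ (by positivity)]
  rw [hm] at hb
  have hsq : b ^ 2 ≤ 2 * (c * (f⁻¹ * min y y⁻¹) * |w|) ^ 2 + 2 * e ^ 2 := by
    calc b ^ 2 = |b| ^ 2 := (sq_abs b).symm
      _ ≤ (c * (f⁻¹ * min y y⁻¹) * |w| + |e|) ^ 2 := by gcongr
      _ ≤ 2 * (c * (f⁻¹ * min y y⁻¹) * |w|) ^ 2 + 2 * |e| ^ 2 := by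
        nlinarith [sq_nonneg (c * (f⁻¹ * min y y⁻¹) * |w| - |e|)]
      _ = _ := by rw [sq_abs e]
  have hmain : A * f ^ 2 * (1 + y) * (c * (f⁻¹ * min y y⁻¹) * |w|) ^ 2 ≤
      4 * c ^ 2 * (A * (y / (1 + y)) * w ^ 2) := by
    have := one_add_sq_mul_min_sq_le hyp'
    calc A * f ^ 2 * (1 + y) * (c * (f⁻¹ * min y y⁻¹) * |w|) ^ 2
        = A * c ^ 2 * w ^ 2 / (1 + y) * ((1 + y) ^ 2 * min y y⁻¹ ^ 2) := by
          rw [mul_pow, mul_pow, mul_pow, sq_abs]; field_simp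
      _ ≤ A * c ^ 2 * w ^ 2 / (1 + y) * (4 * y) := by gcongr
      _ = _ := by field_simp
  rw [e3, e4]
  change _ ≤ 8 * c ^ 2 * (A * (y / (1 + y)) * w ^ 2) + _
  calc (A * f ^ 2 + A * f ^ 2 * y) * b ^ 2
      ≤ (A * f ^ 2 + A * f ^ 2 * y) * (2 * (c * (f⁻¹ * min y y⁻¹) * |w|) ^ 2 + 2 * e ^ 2) := by
        gcongr
    _ = 2 * (A * f ^ 2 * (1 + y) * (c * (f⁻¹ * min y y⁻¹) * |w|) ^ 2)
        + 2 * ((A * f ^ 2 + A * f ^ 2 * y) * e ^ 2) := by ring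
    _ ≤ _ := by linarith

lemma continuousAt_absorbWeight {z : Spacetime n} (hz : 0 < hyp z) (α p : ℝ) :
    ContinuousAt (absorbWeight α p : Spacetime n → ℝ) z := by
  have h1 := (contDiffAt_hyp_rpow hz (α - 1)).continuousAt
  have h2 := (contDiffAt_hyp_rpow hz (p / 2)).continuousAt
  exact h1.mul (h2.div (continuousAt_const.add h2) (by positivity))

/-- The combination of two Carleman estimates absorbs a small potential. -/
lemma carleman_absorb {φ e : Spacetime n → ℝ} {α p c : ℝ} (hα : 0 < α) (hp : 0 < p)
    (hcα : 16 * |c| ≤ α * p) (hφ : ContDiff ℝ 2 φ)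
    (hc : HasCompactSupport φ) (hs : ∀ z ∈ tsupport φ, 0 < hyp z)
    (he : Integrable fun z => (hyp z ^ (α + 1) + hyp z ^ (α + p / 2 + 1)) * e z ^ 2)
    (he0 : ∀ z, hyp z ≤ 0 → e z = 0)
    (hb : ∀ z ∈ tsupport φ, |box φ z| ≤
      c * min (hyp z ^ (-1 + p / 2)) (hyp z ^ (-1 - p / 2)) * |φ z| + |e z|) :
    p ^ 2 / 8 * ∫ z, absorbWeight α p z * φ z ^ 2 ≤
      8 / α ^ 2 * ∫ z, (hyp z ^ (α + 1) + hyp z ^ (α + p / 2 + 1)) * e z ^ 2 := by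
  have h1 := carleman_estimate hα hφ hc hs
  have h2 := carleman_estimate (add_pos hα (half_pos hp)) hφ hc hs
  have cf : ∀ (a : ℝ), ∀ z ∈ tsupport φ, ContinuousAt (fun y : Spacetime n => hyp y ^ a) z :=
    fun a z hz => (contDiffAt_hyp_rpow (hs z hz) a).continuousAt
  have cX : ∀ a z, ContinuousAt (shiftedScaling a φ) z :=
    fun a z => (contDiffAt_shiftedScaling a hφ.contDiffAt).continuousAt
  have cB : ∀ z, ContinuousAt (box φ) z := fun z => continuousAt_box hφ.contDiffAt
  have hzero : ∀ a, ∀ z ∉ tsupport φ, shiftedScaling a φ z = 0 := fun a z hz => by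
    simp [shiftedScaling, scaling, dirDeriv_eq_zero_of_notMem_tsupport _ hz,
      image_eq_zero_of_notMem_tsupport hz]
  have iX : ∀ a, Integrable fun z => hyp z ^ (a - 1) * shiftedScaling a φ z ^ 2 := fun a =>
    integrable_of_continuousAt_tsupport hc (fun z hz => (cf _ z hz).mul ((cX a z).pow 2))
      fun z hz => by simp [hzero a z hz]
  have iB : ∀ a : ℝ, Integrable fun z => hyp z ^ a * box φ z ^ 2 := fun a =>
    integrable_of_continuousAt_tsupport hc (fun z hz => (cf _ z hz).mul ((cB z).pow 2))
      fun z hz => by simp [box_eq_zero_of_notMem_tsupport hz]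
  have iW : Integrable fun z => absorbWeight α p z * φ z ^ 2 :=
    integrable_of_continuousAt_tsupport hc
      (fun z hz => (continuousAt_absorbWeight (hs z hz) α p).mul (hφ.continuous.continuousAt.pow 2))
      fun z hz => by simp [image_eq_zero_of_notMem_tsupport hz]
  set I := ∫ z, absorbWeight α p z * φ z ^ 2
  set K := ∫ z, (hyp z ^ (α + 1) + hyp z ^ (α + p / 2 + 1)) * e z ^ 2
  have lower : p ^ 2 / 4 * I ≤ (∫ z, hyp z ^ (α - 1) * shiftedScaling α φ z ^ 2)
      + ∫ z, hyp z ^ (α + p / 2 - 1) * shiftedScaling (α + p / 2) φ z ^ 2 := by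
    rw [← integral_add (iX α) (iX _), ← integral_const_mul]
    refine integral_mono (iW.const_mul _) ((iX α).add (iX _)) fun z => ?_
    by_cases hz : z ∈ tsupport φ
    · exact absorbWeight_mul_sq_le (hs z hz) α p φ
    · simp [hzero _ z hz, image_eq_zero_of_notMem_tsupport hz]
  have upper : (∫ z, hyp z ^ (α + 1) * box φ z ^ 2)
      + ∫ z, hyp z ^ (α + p / 2 + 1) * box φ z ^ 2 ≤ 8 * c ^ 2 * I + 2 * K := by
    rw [← integral_add (iB _) (iB _), ← integral_const_mul, ← integral_const_mul,
      ← integral_add (iW.const_mul _) (he.const_mul _)]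
    refine integral_mono ((iB _).add (iB _)) ((iW.const_mul _).add (he.const_mul _)) fun z => ?_
    by_cases hz : z ∈ tsupport φ
    · have := weighted_sq_le (hs z hz) α p c _ _ _ (hb z hz)
      simpa only [add_mul] using this
    -- Real powers of a negative base need not be nonnegative, so the vanishing of e outside the
    -- exterior region is used here.
    · have h0 : 0 ≤ (hyp z ^ (α + 1) + hyp z ^ (α + p / 2 + 1)) * e z ^ 2 := by
        rcases lt_or_ge 0 (hyp z) with h | h
        · positivity
        · simp [he0 z h]
      simpa [box_eq_zero_of_notMem_tsupport hz, image_eq_zero_of_notMem_tsupport hz] using h0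
  have hK2 : 0 ≤ ∫ z, hyp z ^ (α + p / 2 + 1) * box φ z ^ 2 := by
    refine integral_nonneg fun z => ?_
    by_cases hz : z ∈ tsupport φ
    · have := hs z hz
      change 0 ≤ hyp z ^ (α + p / 2 + 1) * box φ z ^ 2
      positivity
    · simp [box_eq_zero_of_notMem_tsupport hz]
  have hI : 0 ≤ I := by
    refine integral_nonneg fun z => ?_
    by_cases hz : z ∈ tsupport φ
    · have := hs z hz
      change 0 ≤ absorbWeight α p z * φ z ^ 2
      unfold absorbWeight
      positivity
    · simp [image_eq_zero_of_notMem_tsupport hz]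
  -- The larger exponent has the better Carleman constant, so 4/α² serves for both.
  have h3 : 4 / (α + p / 2) ^ 2 ≤ 4 / α ^ 2 := by gcongr; linarith
  have h4 : p ^ 2 / 4 * I ≤ 4 / α ^ 2 * (8 * c ^ 2 * I + 2 * K) :=
    calc p ^ 2 / 4 * I ≤ _ := lower
      _ ≤ _ := add_le_add h1 (h2.trans (mul_le_mul_of_nonneg_right h3 hK2))
      _ = 4 / α ^ 2 * _ := (mul_add _ _ _).symm
      _ ≤ _ := by gcongr
  have h5 : c ^ 2 ≤ (α * p / 16) ^ 2 := by
    rw [← sq_abs c]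
    gcongr
    linarith
  -- The threshold 16|c| ≤ αp makes the potential cost at most half of the available p²/4.
  have h6 : 4 / α ^ 2 * (8 * c ^ 2 * I) ≤ p ^ 2 / 8 * I := by
    calc 4 / α ^ 2 * (8 * c ^ 2 * I) ≤ 4 / α ^ 2 * (8 * (α * p / 16) ^ 2 * I) := by gcongr
      _ = p ^ 2 / 8 * I := by field_simp; norm_num
  have h7 : 4 / α ^ 2 * (2 * K) = 8 / α ^ 2 * K := by ring
  rw [mul_add] at h4
  linarith

end Absorption

/-! ### Null coordinates, cutoffs and their commutators with the wave operator -/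

section Cutoff

variable {n : ℕ}

/-! ### Null coordinates -/

lemma mem_exterior_iff (z : Spacetime n) : z ∈ exterior n ↔ 0 < hyp z := by
  have h := sq_lt_sq (a := z.1) (b := ‖z.2‖)
  rw [abs_norm] at h
  change |z.1| < ‖z.2‖ ↔ _
  rw [← h, hyp]
  constructor <;> intro h <;> linarith

lemma nullU_mul_nullV (z : Spacetime n) : nullU z * nullV z = -hyp z := by
  simp only [nullU, nullV, hyp, rad]; ring

lemma abs_nullU_mul_nullV {z : Spacetime n} (hz : 0 < hyp z) : |nullU z * nullV z| = hyp z := by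
  rw [nullU_mul_nullV, abs_neg, abs_of_pos hz]

lemma isOpen_exterior : IsOpen (exterior n) := by
  have : exterior n = {z | 0 < hyp z} := by ext z; exact mem_exterior_iff z
  rw [this]
  exact isOpen_lt continuous_const contDiff_hyp.continuous

lemma rad_pos {z : Spacetime n} (hz : z ∈ exterior n) : 0 < rad z :=
  (abs_nonneg _).trans_lt hz

lemma abs_nullU_le_rad {z : Spacetime n} (hz : z ∈ exterior n) : |nullU z| ≤ rad z := by
  have h : |z.1| < rad z := hz
  have := abs_lt.1 h
  rw [nullU, abs_le]; constructor <;> linarith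

lemma abs_nullV_le_rad {z : Spacetime n} (hz : z ∈ exterior n) : |nullV z| ≤ rad z := by
  have h : |z.1| < rad z := hz
  have := abs_lt.1 h
  rw [nullV, abs_le]; constructor <;> linarith

lemma hyp_le_radSq_div_four (z : Spacetime n) : hyp z ≤ radSq z / 4 := by
  simp only [hyp, radSq]; nlinarith [sq_nonneg z.1]

lemma scaling_eq_null {z : Spacetime n} (hz : z ∈ exterior n) (φ : Spacetime n → ℝ) :
    scaling φ z = nullU z * partialU φ z + nullV z * partialV φ z := by
  have hr := (rad_pos hz).ne'
  have e : z = nullU z • ((1, -radialUnit z) : Spacetime n)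
      + nullV z • ((1, radialUnit z) : Spacetime n) := by
    refine Prod.ext ?_ ?_
    · simp [nullU, nullV]; ring
    · simp only [Prod.smul_mk, Prod.snd_add, radialUnit, smul_smul, ← neg_smul, ← add_smul]
      rw [show nullU z * -(rad z)⁻¹ + nullV z * (rad z)⁻¹ = 1 by
        simp only [nullU, nullV]; field_simp; ring, one_smul]
  simp only [scaling, partialU, partialV, dirDeriv]
  conv_lhs => rw [show fderiv ℝ φ z z = fderiv ℝ φ z (nullU z • ((1, -radialUnit z) : Spacetime n)
      + nullV z • ((1, radialUnit z) : Spacetime n)) by rw [← e]]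
  rw [map_add, map_smul, map_smul, smul_eq_mul, smul_eq_mul]

lemma dirDeriv_radial_eq_null {z : Spacetime n} (hz : z ∈ exterior n) (φ : Spacetime n → ℝ) :
    dirDeriv (0, z.2) φ z = rad z / 2 * (partialV φ z - partialU φ z) := by
  have hr := (rad_pos hz).ne'
  have e : ((0, z.2) : Spacetime n) = (rad z / 2) • (((1, radialUnit z) : Spacetime n)
      - ((1, -radialUnit z) : Spacetime n)) := by
    refine Prod.ext ?_ ?_
    · simp
    · simp only [Prod.smul_snd, Prod.snd_sub, radialUnit, sub_neg_eq_add, ← two_smul ℝ, smul_smul]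
      rw [show rad z / 2 * (2 * (rad z)⁻¹) = 1 by field_simp, one_smul]
  simp only [partialU, partialV, dirDeriv]
  rw [e, map_smul, map_sub, smul_eq_mul]

/-! ### Cutting off a function -/

/-- A smooth transition from `0` on `(-∞, 1]` to `1` on `[2, ∞)`, with scale-invariant bounds on the
first two derivatives. -/
lemma exists_transition : ∃ (s s' s'' : ℝ → ℝ) (C : ℝ), 0 ≤ C ∧ ContDiff ℝ 2 s ∧
    (∀ y, HasDerivAt s (s' y) y) ∧ (∀ y, HasDerivAt s' (s'' y) y) ∧
    (∀ y ≤ 1, s y = 0) ∧ (∀ y, 2 ≤ y → s y = 1) ∧ (∀ y, |s y| ≤ 1) ∧ (∀ y, |1 - s y| ≤ 1) ∧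
    (∀ y, |y * s' y| ≤ C) ∧ ∀ y, |y ^ 2 * s'' y| ≤ C := by
  set s : ℝ → ℝ := fun y => Real.smoothTransition (y - 1) with hs
  have hsm : ContDiff ℝ 3 s := Real.smoothTransition.contDiff.comp (contDiff_id.sub contDiff_const)
  have hs' : ContDiff ℝ 2 (deriv s) := by
    rw [show (3 : WithTop ℕ∞) = 2 + 1 by norm_num, contDiff_succ_iff_deriv] at hsm
    exact hsm.2.2
  have hs'' : ContDiff ℝ 1 (deriv (deriv s)) := by
    rw [show (2 : WithTop ℕ∞) = 1 + 1 by norm_num, contDiff_succ_iff_deriv] at hs'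
    exact hs'.2.2
  have h0 : ∀ y ≤ 1, s y = 0 := fun y hy => Real.smoothTransition.zero_of_nonpos (by linarith)
  have h1 : ∀ y, 2 ≤ y → s y = 1 := fun y hy => Real.smoothTransition.one_of_one_le (by linarith)
  -- Both derivatives live on the compact interval [1, 2], so multiplying by y or y² keeps them
  -- bounded, and these bounds are invariant under rescaling y.
  have d1 : ∀ y ∉ Icc (1 : ℝ) 2, deriv s y = 0 := by
    intro y hy
    rw [mem_Icc, not_and_or, not_le, not_le] at hy
    rcases hy with hy | hy
    · have : s =ᶠ[𝓝 y] fun _ => 0 := by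
        filter_upwards [gt_mem_nhds hy] with x hx using h0 x hx.le
      rw [this.deriv_eq, deriv_const]
    · have : s =ᶠ[𝓝 y] fun _ => 1 := by
        filter_upwards [lt_mem_nhds hy] with x hx using h1 x hx.le
      rw [this.deriv_eq, deriv_const]
  have d2 : ∀ y ∉ Icc (1 : ℝ) 2, deriv (deriv s) y = 0 := by
    intro y hy
    have : deriv s =ᶠ[𝓝 y] fun _ => 0 := by
      filter_upwards [isClosed_Icc.isOpen_compl.mem_nhds hy] with x hx using d1 x hx
    rw [this.deriv_eq, deriv_const]
  obtain ⟨C1, hC1⟩ := isCompact_Icc.exists_bound_of_continuousOn (s := Icc (1 : ℝ) 2)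
    (f := fun y => y * deriv s y) (continuous_id.mul hs'.continuous).continuousOn
  obtain ⟨C2, hC2⟩ := isCompact_Icc.exists_bound_of_continuousOn (s := Icc (1 : ℝ) 2)
    (f := fun y => y ^ 2 * deriv (deriv s) y)
    ((continuous_id.pow 2).mul hs''.continuous).continuousOn
  refine ⟨s, deriv s, deriv (deriv s), max 0 (max C1 C2), le_max_left _ _, hsm.of_le (by norm_num),
    fun y => (hsm.differentiable (by norm_num) y).hasDerivAt,
    fun y => (hs'.differentiable (by norm_num) y).hasDerivAt, h0, h1, fun y => ?_, fun y => ?_,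
    fun y => ?_, fun y => ?_⟩
  · rw [abs_le]
    have := Real.smoothTransition.nonneg (y - 1)
    have := Real.smoothTransition.le_one (y - 1)
    simp only [hs]; constructor <;> linarith
  · rw [abs_le]
    have := Real.smoothTransition.nonneg (y - 1)
    have := Real.smoothTransition.le_one (y - 1)
    simp only [hs]; constructor <;> linarith
  · by_cases hy : y ∈ Icc (1 : ℝ) 2
    · exact (hC1 y hy).trans ((le_max_left _ _).trans (le_max_right _ _))
    · simp [d1 y hy]
  · by_cases hy : y ∈ Icc (1 : ℝ) 2
    · exact (hC2 y hy).trans ((le_max_right _ _).trans (le_max_right _ _))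
    · simp [d2 y hy]

/-- The commutator of the wave operator with the multiplication by `χ`. -/
def boxCommutator (χ φ : Spacetime n → ℝ) (z : Spacetime n) : ℝ :=
  box (fun y => χ y * φ y) z - χ z * box φ z

/-- The gradients of f and r² are the scaling field and the radial field up to constants, so a
cutoff in these two variables brings in no angular derivative of φ. -/
lemma boxCommutator_eq {a a' b b' : ℝ → ℝ} {a'' b'' : ℝ} {φ : Spacetime n → ℝ} {z : Spacetime n}
    (ca : ContDiff ℝ 2 a) (cb : ContDiff ℝ 2 b)
    (ha : ∀ y, HasDerivAt a (a' y) y) (ha' : HasDerivAt a' a'' (hyp z))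
    (hb : ∀ y, HasDerivAt b (b' y) y) (hb' : HasDerivAt b' b'' (radSq z))
    (hφ : ContDiffAt ℝ 2 φ z) :
    boxCommutator (fun y => a (hyp y) * b (radSq y)) φ z =
      φ z * (a (hyp z) * (b'' * (4 * radSq z) + b' (radSq z) * (2 * n))
        + b (radSq z) * (a'' * hyp z + a' (hyp z) * ((n + 1) / 2))
        + 2 * (a' (hyp z) * b' (radSq z) * radSq z))
      + 2 * (a (hyp z) * b' (radSq z) * (2 * dirDeriv (0, z.2) φ z)
        + b (radSq z) * a' (hyp z) * (scaling φ z / 2)) := by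
  have cA : ContDiffAt ℝ 2 (fun y : Spacetime n => a (hyp y)) z := (ca.comp contDiff_hyp).contDiffAt
  have cB : ContDiffAt ℝ 2 (fun y : Spacetime n => b (radSq y)) z :=
    (cb.comp contDiff_radSq).contDiffAt
  have dh := (contDiff_hyp (n := n)).contDiffAt.differentiableAt (x := z) (by norm_num)
  have dr := (contDiff_radSq (n := n)).contDiffAt.differentiableAt (x := z) (by norm_num)
  have s1 : scaling hyp z = 2 * hyp z := by
    rw [scaling_eq_sum]
    have := four_mul_hyp z
    simp only [dirDeriv_dir_hyp]
    rw [show 2 * hyp z = (4 * hyp z) / 2 by ring, this, Finset.sum_div]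
    exact Finset.sum_congr rfl fun μ _ => by ring
  have s2 : gradInner radSq radSq z = 4 * radSq z := by
    rw [gradInner_radSq, dirDeriv_radSq, real_inner_self_eq_norm_sq, radSq]; ring
  have s3 : gradInner hyp radSq z = radSq z := by
    rw [gradInner_hyp, scaling, dirDeriv_radSq, real_inner_self_eq_norm_sq, radSq]; ring
  have s4 : gradInner (fun y => a (hyp y)) (fun y => b (radSq y)) z
      = a' (hyp z) * b' (radSq z) * radSq z := by
    rw [gradInner_comp_left (ha _) dh, gradInner_comm, gradInner_comp_left (hb _) dr,
      gradInner_comm, s3]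
    ring
  rw [boxCommutator, box_mul (cA.mul cB) hφ, box_mul cA cB, box_comp ha ha' contDiff_hyp.contDiffAt,
    box_comp hb hb' contDiff_radSq.contDiffAt, s4,
    gradInner_mul_left (cA.differentiableAt (by norm_num)) (cB.differentiableAt (by norm_num)),
    gradInner_comp_left (ha _) dh, gradInner_comp_left (hb _) dr, s2,
    gradInner_hyp, gradInner_hyp, s1, box_hyp, box_radSq, gradInner_radSq]
  ring

lemma abs_mul_le_of_abs_le {x y X Y : ℝ} (hx : |x| ≤ X) (hy : |y| ≤ Y) : |x * y| ≤ X * Y := by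
  rw [abs_mul]
  exact mul_le_mul hx hy (abs_nonneg _) ((abs_nonneg _).trans hx)

/-- Everything is written in the scale-invariant quantities f a', f² a'', r² b', r⁴ b''. Where a
term has f against derivatives of b, the inequality f ≤ r²/4 trades f for r². The constant therefore
does not see the scale of the cutoff. -/
lemma abs_hyp_mul_boxCommutator_le {a a' b b' : ℝ → ℝ} {a'' b'' C : ℝ} {φ : Spacetime n → ℝ}
    {z : Spacetime n} (hz : z ∈ exterior n)
    (ca : ContDiff ℝ 2 a) (cb : ContDiff ℝ 2 b)
    (ha : ∀ y, HasDerivAt a (a' y) y) (ha' : HasDerivAt a' a'' (hyp z))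
    (hb : ∀ y, HasDerivAt b (b' y) y) (hb' : HasDerivAt b' b'' (radSq z))
    (hφ : ContDiffAt ℝ 2 φ z) (ba : |a (hyp z)| ≤ 1) (bb : |b (radSq z)| ≤ 1)
    (ba' : |hyp z * a' (hyp z)| ≤ C) (bb' : |radSq z * b' (radSq z)| ≤ C)
    (ba'' : |hyp z ^ 2 * a''| ≤ C) (bb'' : |radSq z ^ 2 * b''| ≤ C) :
    |hyp z * boxCommutator (fun y => a (hyp y) * b (radSq y)) φ z| ≤
      ((n + 5) * C + 2 * C ^ 2)
        * (|φ z| + (|nullU z * partialU φ z| + |nullV z * partialV φ z|)) := by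
  have hpos := (mem_exterior_iff z).1 hz
  have hr := rad_pos hz
  have hq : radSq z = rad z ^ 2 := rfl
  have hrs : 0 < radSq z := by rw [hq]; positivity
  have hC : 0 ≤ C := (abs_nonneg _).trans ba'
  set f := hyp z
  set R := radSq z
  set P := nullU z * partialU φ z with hP
  set N := nullV z * partialV φ z with hN
  have hfR : |f / R| ≤ 1 / 4 := by
    rw [abs_of_pos (by positivity), div_le_iff₀ hrs]
    linarith [hyp_le_radSq_div_four z]
  have hscale : |scaling φ z| ≤ |P| + |N| := by
    rw [scaling_eq_null hz]; exact abs_add_le _ _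
  -- Of the two factors in f = -uv, one joins the matching null derivative and the other is bounded
  -- by r.
  have hrad : |f * (2 * dirDeriv (0, z.2) φ z)| ≤ R * (|P| + |N|) := by
    have e : f * (2 * dirDeriv (0, z.2) φ z) = rad z * (nullV z * P - nullU z * N) := by
      rw [dirDeriv_radial_eq_null hz, show f = -(nullU z * nullV z) by rw [nullU_mul_nullV]; ring]
      simp only [hP, hN]; ring
    have hu := abs_mul_le_of_abs_le (abs_nullU_le_rad hz) (le_refl |N|)
    have hv := abs_mul_le_of_abs_le (abs_nullV_le_rad hz) (le_refl |P|)
    rw [e, abs_mul, abs_of_pos hr, hq]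
    calc rad z * |nullV z * P - nullU z * N|
        ≤ rad z * (rad z * |P| + rad z * |N|) := by
          gcongr; exact (abs_sub _ _).trans (by linarith)
      _ = _ := by ring
  have t1 : |f / R * (R ^ 2 * b'') * a f * 4| ≤ C := by
    have := abs_mul_le_of_abs_le (abs_mul_le_of_abs_le hfR bb'') ba
    rw [abs_mul, abs_of_pos (by norm_num : (0 : ℝ) < 4)]; linarith
  have t2 : |f / R * (R * b' R) * a f * (2 * n)| ≤ 1 / 4 * C * 1 * (2 * n) :=
    abs_mul_le_of_abs_le (abs_mul_le_of_abs_le (abs_mul_le_of_abs_le hfR bb') ba)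
      (abs_of_nonneg (by positivity)).le
  have t3 : |f ^ 2 * a'' * b R| ≤ C * 1 := abs_mul_le_of_abs_le ba'' bb
  have t4 : |f * a' f * b R * ((n + 1) / 2)| ≤ C * 1 * ((n + 1) / 2) :=
    abs_mul_le_of_abs_le (abs_mul_le_of_abs_le ba' bb) (abs_of_nonneg (by positivity)).le
  have t5 : |f * a' f * (R * b' R) * 2| ≤ C * C * 2 :=
    abs_mul_le_of_abs_le (abs_mul_le_of_abs_le ba' bb') (abs_of_nonneg (by positivity)).le
  have t6 : |a f * (b' R * (f * (2 * dirDeriv (0, z.2) φ z))) * 2| ≤ 1 * (C * (|P| + |N|)) * 2 := by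
    refine abs_mul_le_of_abs_le (abs_mul_le_of_abs_le ba ?_) (abs_of_nonneg (by positivity)).le
    rw [abs_mul]
    calc |b' R| * |f * (2 * dirDeriv (0, z.2) φ z)| ≤ |b' R| * (R * (|P| + |N|)) := by gcongr
      _ = |R * b' R| * (|P| + |N|) := by rw [abs_mul R, abs_of_pos hrs]; ring
      _ ≤ _ := by gcongr
  have t7 : |f * a' f * b R * scaling φ z| ≤ C * 1 * (|P| + |N|) :=
    abs_mul_le_of_abs_le (abs_mul_le_of_abs_le ba' bb) hscale
  have e : f * boxCommutator (fun y => a (hyp y) * b (radSq y)) φ z =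
      φ z * (f / R * (R ^ 2 * b'') * a f * 4 + f / R * (R * b' R) * a f * (2 * n)
        + f ^ 2 * a'' * b R + f * a' f * b R * ((n + 1) / 2) + f * a' f * (R * b' R) * 2)
      + (a f * (b' R * (f * (2 * dirDeriv (0, z.2) φ z))) * 2 + f * a' f * b R * scaling φ z) := by
    rw [boxCommutator_eq ca cb ha ha' hb hb' hφ]
    change f * (φ z * (a f * (b'' * (4 * R) + b' R * (2 * n)) + b R * (a'' * f + a' f * ((n + 1) / 2))
        + 2 * (a' f * b' R * R))
      + 2 * (a f * b' R * (2 * dirDeriv (0, z.2) φ z) + b R * a' f * (scaling φ z / 2))) = _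
    field_simp
    ring
  rw [e]
  have hsum : |f / R * (R ^ 2 * b'') * a f * 4 + f / R * (R * b' R) * a f * (2 * n)
        + f ^ 2 * a'' * b R + f * a' f * b R * ((n + 1) / 2) + f * a' f * (R * b' R) * 2|
        ≤ (n + 5) * C + 2 * C ^ 2 := by
    refine (abs_add_le _ _).trans ?_
    have := (abs_add_le _ _).trans (add_le_add ((abs_add_le _ _).trans
      (add_le_add ((abs_add_le _ _).trans (add_le_add t1 t2)) t3)) t4)
    have hn : (0 : ℝ) ≤ n * C := by positivity
    linarith
  have hsum2 : |a f * (b' R * (f * (2 * dirDeriv (0, z.2) φ z))) * 2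
      + f * a' f * b R * scaling φ z| ≤ ((n + 5) * C + 2 * C ^ 2) * (|P| + |N|) := by
    refine ((abs_add_le _ _).trans (add_le_add t6 t7)).trans ?_
    have hn : (0 : ℝ) ≤ (n + 2) * C + 2 * C ^ 2 := by positivity
    have := mul_nonneg hn (by positivity : 0 ≤ |P| + |N|)
    linarith
  refine (abs_add_le _ _).trans ?_
  have := abs_mul_le_of_abs_le (le_refl |φ z|) hsum
  linarith

/-- The properties of a family of cutoff functions which exhausts the exterior region. -/
structure ExteriorCutoff (χ : ℕ → Spacetime n → ℝ) (C : ℝ) : Prop where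
  contDiff : ∀ m, ContDiff ℝ 2 (χ m)
  hasCompactSupport : ∀ m, HasCompactSupport (χ m)
  tsupport_subset : ∀ m, tsupport (χ m) ⊆ exterior n
  abs_le_one : ∀ m z, |χ m z| ≤ 1
  eventually_eq_one : ∀ z ∈ exterior n, ∀ᶠ m in atTop, χ m =ᶠ[𝓝 z] fun _ => 1
  commutator_le : ∀ m, ∀ z ∈ exterior n, ∀ φ : Spacetime n → ℝ, ContDiffAt ℝ 2 φ z →
    |hyp z * boxCommutator (χ m) φ z| ≤
      C * (|φ z| + (|nullU z * partialU φ z| + |nullV z * partialV φ z|))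

lemma exists_exteriorCutoff (n : ℕ) :
    ∃ (χ : ℕ → Spacetime n → ℝ) (C : ℝ), ExteriorCutoff χ C := by
  obtain ⟨s, s', s'', C, hC, cs, hs, hs', s0, s1, bs, bs1, bs', bs''⟩ := exists_transition
  -- The first factor removes a neighbourhood of the null cone, the second removes large r; since
  -- |t| < r on the exterior region, t is then bounded as well.
  set χ : ℕ → Spacetime n → ℝ := fun m z =>
    s (((m : ℝ) + 1) * hyp z) * (1 - s (radSq z / ((m : ℝ) + 1))) with hχ
  have hm : ∀ m : ℕ, (0 : ℝ) < (m : ℝ) + 1 := fun m => by positivity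
  have ca : ∀ m : ℕ, ContDiff ℝ 2 fun y : ℝ => s (((m : ℝ) + 1) * y) := fun m =>
    cs.comp (contDiff_const.mul contDiff_id)
  have cb : ∀ m : ℕ, ContDiff ℝ 2 fun y : ℝ => 1 - s (y / ((m : ℝ) + 1)) := fun m =>
    contDiff_const.sub (cs.comp (contDiff_id.div_const _))
  have hsub : ∀ m, tsupport (χ m) ⊆
      {z | 1 ≤ ((m : ℝ) + 1) * hyp z ∧ radSq z / ((m : ℝ) + 1) ≤ 2} := by
    intro m
    refine closure_minimal (fun z hz => ?_) ?_
    · by_contra h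
      rw [mem_ofPred_eq, not_and_or, not_le, not_le] at h
      refine hz ?_
      rcases h with h | h
      · simp [hχ, s0 _ h.le]
      · simp [hχ, s1 _ h.le]
    · exact (isClosed_le continuous_const (continuous_const.mul contDiff_hyp.continuous)).inter
        (isClosed_le (contDiff_radSq.continuous.div_const _) continuous_const)
  have hpos : ∀ m z, z ∈ tsupport (χ m) → 0 < hyp z := fun m z hz => by
    have h := (hsub m hz).1
    by_contra h'
    have := mul_nonpos_of_nonneg_of_nonpos (hm m).le (not_lt.1 h')
    linarith
  refine ⟨χ, (n + 5) * C + 2 * C ^ 2, fun m => ?_, fun m => ?_, fun m z hz => ?_, fun m z => ?_,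
    fun z hz => ?_, fun m z hz φ hφ => ?_⟩
  · exact ((ca m).comp contDiff_hyp).mul ((cb m).comp contDiff_radSq)
  · refine HasCompactSupport.of_support_subset_isCompact
      (isCompact_closedBall (0 : Spacetime n) (2 * ((m : ℝ) + 1) + 1)) fun z hz => ?_
    have hz' := subset_tsupport _ hz
    have h2 := (hsub m hz').2
    rw [div_le_iff₀ (hm m), radSq] at h2
    have hx : ‖z.2‖ ≤ 2 * ((m : ℝ) + 1) + 1 := by nlinarith [sq_nonneg (‖z.2‖ - 1)]
    have ht : |z.1| < ‖z.2‖ := (mem_exterior_iff z).2 (hpos m z hz')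
    rw [mem_closedBall_zero_iff, Prod.norm_def]
    exact max_le (ht.le.trans hx) hx
  · exact (mem_exterior_iff z).2 (hpos m z hz)
  · exact (abs_mul_le_of_abs_le (bs _) (bs1 _)).trans_eq (one_mul 1)
  · have hf := (mem_exterior_iff z).1 hz
    obtain ⟨M, hM⟩ := exists_nat_gt (max (2 / hyp z) (radSq z))
    filter_upwards [eventually_ge_atTop M] with m hmM
    have hmM' : (M : ℝ) ≤ m := by exact_mod_cast hmM
    have h1 : 2 < ((m : ℝ) + 1) * hyp z := by
      have : 2 / hyp z < (m : ℝ) + 1 := by linarith [le_max_left (2 / hyp z) (radSq z)]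
      exact (div_lt_iff₀ hf).1 this
    have h2 : radSq z / ((m : ℝ) + 1) < 1 := by
      rw [div_lt_one (hm m)]; linarith [le_max_right (2 / hyp z) (radSq z)]
    have o1 : ∀ᶠ y in 𝓝 z, 2 < ((m : ℝ) + 1) * hyp y :=
      (continuous_const.mul contDiff_hyp.continuous).continuousAt.eventually_const_lt h1
    have o2 : ∀ᶠ y : Spacetime n in 𝓝 z, radSq y / ((m : ℝ) + 1) < 1 :=
      (contDiff_radSq.continuous.div_const _).continuousAt.eventually_lt_const h2
    filter_upwards [o1, o2] with y h1 h2
    simp [hχ, s0 _ h2.le, s1 _ h1.le]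
  · have m0 := (hm m).ne'
    refine abs_hyp_mul_boxCommutator_le (a := fun y => s (((m : ℝ) + 1) * y))
      (a' := fun y => ((m : ℝ) + 1) * s' (((m : ℝ) + 1) * y))
      (b := fun y => 1 - s (y / ((m : ℝ) + 1)))
      (b' := fun y => -(s' (y / ((m : ℝ) + 1)) / ((m : ℝ) + 1)))
      (a'' := ((m : ℝ) + 1) * (s'' (((m : ℝ) + 1) * hyp z) * ((m : ℝ) + 1)))
      (b'' := -(s'' (radSq z / ((m : ℝ) + 1)) * (1 / ((m : ℝ) + 1)) / ((m : ℝ) + 1)))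
      hz (ca m) (cb m) (fun y => ?_) ?_ (fun y => ?_) ?_ hφ (bs _) (bs1 _) ?_ ?_ ?_ ?_
    · have := (hs (((m : ℝ) + 1) * y)).comp y ((hasDerivAt_id y).const_mul ((m : ℝ) + 1))
      exact this.congr_deriv (by ring)
    · have := ((hs' (((m : ℝ) + 1) * hyp z)).comp (hyp z)
        ((hasDerivAt_id (hyp z)).const_mul ((m : ℝ) + 1))).const_mul ((m : ℝ) + 1)
      exact this.congr_deriv (by ring)
    · have := ((hs (y / ((m : ℝ) + 1))).comp y
        ((hasDerivAt_id y).div_const ((m : ℝ) + 1))).const_sub 1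
      exact this.congr_deriv (by ring)
    · have := (((hs' (radSq z / ((m : ℝ) + 1))).comp (radSq z)
        ((hasDerivAt_id (radSq z)).div_const ((m : ℝ) + 1))).div_const ((m : ℝ) + 1)).neg
      exact this
    · convert bs' (((m : ℝ) + 1) * hyp z) using 2; ring
    · convert bs' (radSq z / ((m : ℝ) + 1)) using 1
      rw [← abs_neg]; congr 1; field_simp
    · convert bs'' (((m : ℝ) + 1) * hyp z) using 2; ring
    · convert bs'' (radSq z / ((m : ℝ) + 1)) using 1
      rw [← abs_neg]; congr 1; field_simp

end Cutoff

/-! ### Weighted integrals in polar and null coordinates -/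

section Integrability

/-! ### Integrability of the squared decay rate -/

/-- Integration of radial functions in polar coordinates, for the Lebesgue integral. -/
lemma lintegral_fun_norm {E : Type*} [NormedAddCommGroup E] [NormedSpace ℝ E] [Nontrivial E]
    [FiniteDimensional ℝ E] [MeasurableSpace E] [BorelSpace E] (μ : Measure E)
    [μ.IsAddHaarMeasure] {f : ℝ → ℝ≥0∞} (hf : Measurable f) :
    ∫⁻ x, f ‖x‖ ∂μ = μ.toSphere univ *
      ∫⁻ y in Ioi (0 : ℝ), ENNReal.ofReal (y ^ (Module.finrank ℝ E - 1)) * f y := by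
  calc ∫⁻ x, f ‖x‖ ∂μ = ∫⁻ x in {(0 : E)}ᶜ, f ‖x‖ ∂μ := by rw [restrict_compl_singleton]
    _ = ∫⁻ x : ({(0)}ᶜ : Set E), f ‖x.1‖ ∂(μ.comap (↑)) :=
      (lintegral_subtype_comap (measurableSet_singleton _).compl fun x => f ‖x‖).symm
    _ = ∫⁻ x, f x.2 ∂μ.toSphere.prod (.volumeIoiPow (Module.finrank ℝ E - 1)) := by
      simpa using μ.measurePreserving_homeomorphUnitSphereProd.lintegral_comp_emb
        (Homeomorph.measurableEmbedding _) (f ∘ Subtype.val ∘ Prod.snd)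
    _ = μ.toSphere univ * ∫⁻ y : Ioi (0 : ℝ), f y ∂.volumeIoiPow (Module.finrank ℝ E - 1) := by
      rw [lintegral_prod _ (by fun_prop)]
      simp [mul_comm]
    _ = _ := by
      congr 1
      rw [Measure.volumeIoiPow, lintegral_withDensity_eq_lintegral_mul _ (by fun_prop) (by fun_prop)]
      exact lintegral_subtype_comap measurableSet_Ioi
        fun y : ℝ => ENNReal.ofReal (y ^ (Module.finrank ℝ E - 1)) * f y

/-- Convergence at 0 comes from α > 0 and at infinity from α < β; this is the window in which the
Carleman exponents must lie. -/
lemma integrableOn_rpow_mul_one_add_rpow {α β : ℝ} (hα : 0 < α) (hβ : α < β) :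
    IntegrableOn (fun y : ℝ => y ^ (α - 1) * (1 + y) ^ (-β)) (Ioi 0) := by
  have hc : ContinuousOn (fun y : ℝ => y ^ (α - 1) * (1 + y) ^ (-β)) (Ioi 0) := by
    intro y hy
    have hy' : (0 : ℝ) < y := hy
    refine ((continuousAt_id.rpow_const (Or.inl hy'.ne')).mul
      ((continuousAt_const.add continuousAt_id).rpow_const (Or.inl ?_))).continuousWithinAt
    exact (by linarith : (0 : ℝ) < 1 + y).ne'
  rw [← Ioc_union_Ioi_eq_Ioi zero_le_one]
  refine IntegrableOn.union ?_ ?_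
  · have h := (intervalIntegral.intervalIntegrable_rpow' (a := 0) (b := 1)
      (by linarith : -1 < α - 1)).1
    refine Integrable.mono' h ((hc.mono Ioc_subset_Ioi_self).aestronglyMeasurable measurableSet_Ioc) ?_
    filter_upwards [ae_restrict_mem measurableSet_Ioc] with y hy
    have hy0 := hy.1
    rw [Real.norm_of_nonneg (by positivity)]
    have : (1 + y) ^ (-β) ≤ 1 := Real.rpow_le_one_of_one_le_of_nonpos (by linarith) (by linarith)
    exact mul_le_of_le_one_right (by positivity) this
  · have h := integrableOn_Ioi_rpow_of_lt (by linarith : α - 1 - β < -1) zero_lt_one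
    refine Integrable.mono' h ((hc.mono (Ioi_subset_Ioi zero_le_one)).aestronglyMeasurable
      measurableSet_Ioi) ?_
    filter_upwards [ae_restrict_mem measurableSet_Ioi] with y hy
    have hy1 : (1 : ℝ) < y := hy
    have hy0 : 0 < y := by linarith
    rw [Real.norm_of_nonneg (by positivity), sub_eq_add_neg (α - 1), Real.rpow_add hy0]
    have : (1 + y) ^ (-β) ≤ y ^ (-β) :=
      Real.rpow_le_rpow_of_nonpos hy0 (by linarith) (by linarith)
    gcongr

/-- The one-dimensional profile of the squared decay rate in each null coordinate. -/
def nullProfile (α β : ℝ) : ℝ → ℝ :=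
  (Ioi (0 : ℝ)).indicator fun y => y ^ (α - 1) * (1 + y) ^ (-β)

lemma measurable_nullProfile (α β : ℝ) : Measurable (nullProfile α β) :=
  Measurable.indicator (by fun_prop) measurableSet_Ioi

lemma integrable_nullProfile {α β : ℝ} (hα : 0 < α) (hβ : α < β) :
    Integrable (nullProfile α β) :=
  (integrable_indicator_iff measurableSet_Ioi).2 (integrableOn_rpow_mul_one_add_rpow hα hβ)

lemma lintegral_null_lt_top {κ : ℝ → ℝ} (hκ : Integrable κ) (hm : Measurable κ) :
    ∫⁻ r : ℝ, ∫⁻ t : ℝ, ENNReal.ofReal (κ ((r - t) / 2)) * ENNReal.ofReal (κ ((r + t) / 2)) < ∞ := by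
  have h1 : ∫⁻ y, ENNReal.ofReal (κ y) < ∞ := hκ.lintegral_lt_top
  have h2 : ∫⁻ y, ENNReal.ofReal (κ (y / 2)) < ∞ :=
    (hκ.comp_div (two_ne_zero : (2 : ℝ) ≠ 0)).lintegral_lt_top
  have e : ∀ r : ℝ, ∫⁻ t : ℝ, ENNReal.ofReal (κ ((r - t) / 2)) * ENNReal.ofReal (κ ((r + t) / 2))
      = ∫⁻ t : ℝ, ENNReal.ofReal (κ (r - t / 2)) * ENNReal.ofReal (κ (t / 2)) := by
    intro r
    -- Translating t by r makes the second factor depend on t alone, so Tonelli splits the double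
    -- integral into a product.
    rw [← lintegral_sub_right_eq_self _ r]
    refine lintegral_congr fun t => ?_
    ring_nf
  simp only [e]
  rw [lintegral_lintegral_swap (by fun_prop)]
  have e2 : ∀ t : ℝ, ∫⁻ r : ℝ, ENNReal.ofReal (κ (r - t / 2)) * ENNReal.ofReal (κ (t / 2))
      = (∫⁻ y, ENNReal.ofReal (κ y)) * ENNReal.ofReal (κ (t / 2)) := by
    intro t
    rw [lintegral_mul_const _ (by fun_prop),
      lintegral_sub_right_eq_self (fun y => ENNReal.ofReal (κ y))]
  simp only [e2]
  rw [lintegral_const_mul _ (by fun_prop)]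
  exact ENNReal.mul_lt_top h1 h2

variable {n : ℕ}

lemma decayWeight_pos (β : ℝ) (z : Spacetime n) : 0 < decayWeight β z := by
  unfold decayWeight; positivity

/-- With a = |u| and b = |v| one has f = ab and r = a + b ≤ (1+a)(1+b). The dimensional part of the
squared decay thus supplies r^(-(n-1)), which cancels the polar Jacobian, and the rest factors into
one profile for each null coordinate. -/
lemma hyp_rpow_mul_decayWeight_le (hn : 1 ≤ n) (α β : ℝ) {z : Spacetime n} (hz : z ∈ exterior n) :
    hyp z ^ (α - 1) * ((decayWeight β z) ^ 2)⁻¹ ≤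
      (‖z.2‖ ^ (n - 1))⁻¹ *
        (nullProfile α β ((‖z.2‖ - z.1) / 2) * nullProfile α β ((‖z.2‖ + z.1) / 2)) := by
  have ht : |z.1| < ‖z.2‖ := hz
  have ht' := abs_lt.1 ht
  have hr : 0 < ‖z.2‖ := rad_pos hz
  set a := (‖z.2‖ - z.1) / 2 with ha
  set b := (‖z.2‖ + z.1) / 2 with hb
  have ha0 : 0 < a := by rw [ha]; linarith
  have hb0 : 0 < b := by rw [hb]; linarith
  have eu : |nullU z| = a := by
    rw [← abs_neg, show -nullU z = a by simp only [nullU, rad, ha]; ring, abs_of_pos ha0]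
  have ev : |nullV z| = b := by
    rw [show nullV z = b by simp only [nullV, rad, hb]; ring, abs_of_pos hb0]
  have eh : hyp z = a * b := by simp only [hyp, ha, hb]; ring
  have er : ‖z.2‖ = a + b := by rw [ha, hb]; ring
  have ew : (decayWeight β z) ^ 2 = ((1 + a) * (1 + b)) ^ (n - 1) * ((1 + a) * (1 + b)) ^ β := by
    rw [decayWeight, eu, ev, ← Real.rpow_natCast, ← Real.rpow_mul (by positivity),
      ← Real.rpow_natCast, ← Real.rpow_add (by positivity)]
    congr 1
    push_cast [hn]
    ring
  have e1 : nullProfile α β a = a ^ (α - 1) * (1 + a) ^ (-β) := indicator_of_mem (mem_Ioi.2 ha0) _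
  have e2 : nullProfile α β b = b ^ (α - 1) * (1 + b) ^ (-β) := indicator_of_mem (mem_Ioi.2 hb0) _
  rw [ew, eh, e1, e2, er, Real.mul_rpow ha0.le hb0.le, mul_inv, ← Real.rpow_neg (by positivity),
    Real.mul_rpow (by positivity) (by positivity)]
  have hle : (((1 + a) * (1 + b)) ^ (n - 1))⁻¹ ≤ ((a + b) ^ (n - 1))⁻¹ := by
    gcongr
    nlinarith
  calc a ^ (α - 1) * b ^ (α - 1)
        * ((((1 + a) * (1 + b)) ^ (n - 1))⁻¹ * ((1 + a) ^ (-β) * (1 + b) ^ (-β)))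
      ≤ a ^ (α - 1) * b ^ (α - 1)
        * (((a + b) ^ (n - 1))⁻¹ * ((1 + a) ^ (-β) * (1 + b) ^ (-β))) := by gcongr
    _ = _ := by ring

lemma continuous_nullU : Continuous (nullU : Spacetime n → ℝ) :=
  (continuous_fst.sub continuous_snd.norm).div_const 2

lemma continuous_nullV : Continuous (nullV : Spacetime n → ℝ) :=
  (continuous_fst.add continuous_snd.norm).div_const 2

lemma continuous_decayWeight (β : ℝ) : Continuous (decayWeight β : Spacetime n → ℝ) := by
  refine Continuous.rpow_const ?_ fun z => Or.inl (by positivity)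
  exact (continuous_const.add continuous_nullU.abs).mul (continuous_const.add continuous_nullV.abs)

lemma integrableOn_hyp_rpow_mul_decayWeight (hn : 1 ≤ n) {α β : ℝ} (hα : 0 < α) (hβ : α < β) :
    IntegrableOn (fun z => hyp z ^ (α - 1) * ((decayWeight β z) ^ 2)⁻¹) (exterior n) := by
  have hmeas : MeasurableSet (exterior n) := isOpen_exterior.measurableSet
  have hcont : ContinuousOn (fun z => hyp z ^ (α - 1) * ((decayWeight β z) ^ 2)⁻¹) (exterior n) :=
    fun z hz => ((contDiffAt_hyp_rpow ((mem_exterior_iff z).1 hz) _).continuousAt.mul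
      (((continuous_decayWeight β).continuousAt.pow 2).inv₀
        (pow_pos (decayWeight_pos β z) 2).ne')).continuousWithinAt
  refine ⟨hcont.aestronglyMeasurable hmeas, ?_⟩
  rw [hasFiniteIntegral_iff_norm]
  set κ := nullProfile α β with hκ
  have hκm : Measurable κ := measurable_nullProfile α β
  have hκ0 : ∀ y, 0 ≤ κ y := fun y => indicator_nonneg (fun y hy => by
    have : (0 : ℝ) < y := hy
    positivity) y
  set L : ℝ → ℝ → ℝ≥0∞ := fun t r => ENNReal.ofReal ((r ^ (n - 1))⁻¹) *
    (ENNReal.ofReal (κ ((r - t) / 2)) * ENNReal.ofReal (κ ((r + t) / 2))) with hL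
  have hLm : Measurable (Function.uncurry L) := by
    simp only [hL, Function.uncurry_def]; fun_prop
  have : Nontrivial (EuclideanSpace ℝ (Fin n)) := by
    have : Nonempty (Fin n) := ⟨⟨0, hn⟩⟩
    infer_instance
  have hInner : Measurable fun r : ℝ => ∫⁻ t, L t r :=
    Measurable.lintegral_prod_right' (f := fun q : ℝ × ℝ => L q.2 q.1) (hLm.comp measurable_swap)
  calc ∫⁻ z in exterior n, ENNReal.ofReal ‖hyp z ^ (α - 1) * ((decayWeight β z) ^ 2)⁻¹‖
      ≤ ∫⁻ z in exterior n, L z.1 ‖z.2‖ := by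
        refine setLIntegral_mono' hmeas fun z hz => ?_
        have hp := (mem_exterior_iff z).1 hz
        have hd := decayWeight_pos β z
        rw [Real.norm_of_nonneg (by positivity)]
        simp only [hL]
        rw [← ENNReal.ofReal_mul (hκ0 _), ← ENNReal.ofReal_mul (by positivity)]
        exact ENNReal.ofReal_le_ofReal (hyp_rpow_mul_decayWeight_le hn α β hz)
    _ ≤ ∫⁻ z : Spacetime n, L z.1 ‖z.2‖ := setLIntegral_le_lintegral _ _
    _ = ∫⁻ x : EuclideanSpace ℝ (Fin n), ∫⁻ t, L t ‖x‖ :=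
        lintegral_prod_symm _ (hLm.comp (measurable_fst.prodMk measurable_snd.norm)).aemeasurable
    _ = (volume : Measure (EuclideanSpace ℝ (Fin n))).toSphere univ *
        ∫⁻ r in Ioi (0 : ℝ), ENNReal.ofReal (r ^ (n - 1)) * ∫⁻ t, L t r := by
        rw [lintegral_fun_norm _ hInner, finrank_euclideanSpace_fin]
    _ ≤ (volume : Measure (EuclideanSpace ℝ (Fin n))).toSphere univ *
        ∫⁻ r : ℝ, ∫⁻ t : ℝ, ENNReal.ofReal (κ ((r - t) / 2)) * ENNReal.ofReal (κ ((r + t) / 2)) := by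
        refine mul_le_mul' le_rfl ?_
        refine le_trans (setLIntegral_mono' measurableSet_Ioi fun r hr => ?_)
          (setLIntegral_le_lintegral (Ioi (0 : ℝ)) _)
        have hr' : (0 : ℝ) < r := hr
        simp only [hL]
        rw [lintegral_const_mul _ (by fun_prop), ← mul_assoc, ← ENNReal.ofReal_mul (by positivity),
          mul_inv_cancel₀ (by positivity), ENNReal.ofReal_one, one_mul]
    _ < ∞ := ENNReal.mul_lt_top (measure_lt_top _ _)
        (lintegral_null_lt_top (integrable_nullProfile hα hβ) hκm)

end Integrability

/-! ### Removal of the cutoffs and vanishing of the solution -/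

section UniqueContinuation

variable {n : ℕ}

/-- The size of `φ` and of its scale-invariant null derivatives. -/
def nullSize (φ : Spacetime n → ℝ) (z : Spacetime n) : ℝ :=
  |φ z| + (|nullU z * partialU φ z| + |nullV z * partialV φ z|)

lemma Decays.exists_nullSize_le {β : ℝ} {φ : Spacetime n → ℝ} (h : Decays β φ) :
    ∃ K, 0 ≤ K ∧ ∀ z ∈ exterior n, nullSize φ z ≤ K * (decayWeight β z)⁻¹ := by
  obtain ⟨K1, h1⟩ := h.null_derivatives
  obtain ⟨K2, h2⟩ := h.function
  refine ⟨max 0 (K1 + K2), le_max_left _ _, fun z hz => ?_⟩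
  have d := decayWeight_pos β z
  have b1 := h1 (mem_image_of_mem _ hz)
  have b2 := h2 (mem_image_of_mem _ hz)
  rw [← div_eq_mul_inv, le_div_iff₀ d]
  refine le_trans ?_ (le_max_right _ _)
  rw [nullSize]
  linarith

lemma box_congr {φ ψ : Spacetime n → ℝ} {z : Spacetime n} (h : φ =ᶠ[𝓝 z] ψ) :
    box φ z = box ψ z := by
  simp only [box_eq_sum]
  refine Finset.sum_congr rfl fun μ _ => ?_
  rw [dirDeriv_congr _ (h.eventually_nhds.mono fun y hy => dirDeriv_congr (dir μ) hy)]

lemma boxCommutator_eq_zero_of_eq_one {χ φ : Spacetime n → ℝ} {z : Spacetime n}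
    (h : χ =ᶠ[𝓝 z] fun _ => 1) : boxCommutator χ φ z = 0 := by
  rw [boxCommutator, box_congr (ψ := φ) (h.mono fun y hy => by simp [hy]), h.self_of_nhds]
  ring

lemma boxCommutator_eq_zero_of_notMem_tsupport {χ φ : Spacetime n → ℝ} {z : Spacetime n}
    (h : z ∉ tsupport χ) : boxCommutator χ φ z = 0 := by
  rw [boxCommutator, box_eq_zero_of_notMem_tsupport fun h' => h (tsupport_mul_subset_left h'),
    image_eq_zero_of_notMem_tsupport h]
  ring

/-- A function on the exterior region satisfying the decay conditions and a wave inequality with a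
sufficiently small potential vanishes. -/
lemma eq_zero_of_box_le (hn : 1 ≤ n) {β p c : ℝ} (hp : 0 < p) (hβ : p < β)
    (hc : 64 * |c| ≤ β * p) {φ : Spacetime n → ℝ} (hφ : ContDiffOn ℝ 2 φ (exterior n))
    (hdecay : Decays β φ)
    (hbox : ∀ z ∈ exterior n, |box φ z| ≤
      c * min (hyp z ^ (-1 + p / 2)) (hyp z ^ (-1 - p / 2)) * |φ z|)
    {z : Spacetime n} (hz : z ∈ exterior n) : φ z = 0 := by
  obtain ⟨χ, C, hχ⟩ := exists_exteriorCutoff n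
  obtain ⟨K, hK, hsize⟩ := hdecay.exists_nullSize_le
  -- Since p < β, both α and α + p/2 < 3β/4 lie in (0, β), and 16|c| ≤ αp becomes 64|c| ≤ βp.
  set α : ℝ := β / 4 with hα
  have hα0 : 0 < α := by rw [hα]; linarith
  have hφat : ∀ z ∈ exterior n, ContDiffAt ℝ 2 φ z := fun z hz =>
    hφ.contDiffAt (isOpen_exterior.mem_nhds hz)
  have hposD : ∀ z ∈ exterior n, 0 < hyp z := fun z hz => (mem_exterior_iff z).1 hz
  have hmeas : MeasurableSet (exterior n) := isOpen_exterior.measurableSet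
  set e : ℕ → Spacetime n → ℝ := fun m => boxCommutator (χ m) φ with he
  set Φ : ℕ → Spacetime n → ℝ := fun m z => χ m z * φ z with hΦ
  have hΦt : ∀ m, tsupport (Φ m) ⊆ tsupport (χ m) := fun m => tsupport_mul_subset_left
  have hΦc : ∀ m, ContDiff ℝ 2 (Φ m) := fun m => contDiff_of_contDiffAt_tsupport fun z hz =>
    (hχ.contDiff m).contDiffAt.mul (hφat z (hχ.tsupport_subset m (hΦt m hz)))
  have hχ0 : ∀ m, ∀ z ∉ exterior n, z ∉ tsupport (χ m) := fun m z hz h =>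
    hz (hχ.tsupport_subset m h)
  have he0 : ∀ m, ∀ z ∉ exterior n, e m z = 0 := fun m z hz =>
    boxCommutator_eq_zero_of_notMem_tsupport (hχ0 m z hz)
  have cf : ∀ a : ℝ, ∀ z ∈ exterior n, ContinuousAt (fun y : Spacetime n => hyp y ^ a) z :=
    fun a z hz => (contDiffAt_hyp_rpow (hposD z hz) a).continuousAt
  have ce : ∀ m, ∀ z ∈ exterior n, ContinuousAt (e m) z := fun m z hz =>
    (continuousAt_box (hΦc m).contDiffAt).sub
      ((hχ.contDiff m).continuous.continuousAt.mul (continuousAt_box (hφat z hz)))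
  set G : ℕ → Spacetime n → ℝ := fun m z =>
    (hyp z ^ (α + 1) + hyp z ^ (α + p / 2 + 1)) * e m z ^ 2 with hG
  set H : ℕ → Spacetime n → ℝ := fun m z => absorbWeight α p z * Φ m z ^ 2 with hH
  have cG : ∀ m, ∀ z ∈ exterior n, ContinuousAt (G m) z := fun m z hz =>
    ((cf _ z hz).add (cf _ z hz)).mul ((ce m z hz).pow 2)
  have cH : ∀ m, ∀ z ∈ exterior n, ContinuousAt (H m) z := fun m z hz =>
    (continuousAt_absorbWeight (hposD z hz) α p).mul ((hΦc m).continuous.continuousAt.pow 2)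
  have key : ∀ m, p ^ 2 / 8 * ∫ z in exterior n, H m z ≤
      8 / α ^ 2 * ∫ z in exterior n, G m z := by
    intro m
    rw [setIntegral_eq_integral_of_forall_compl_eq_zero fun z hz => by
        simp [hH, hΦ, image_eq_zero_of_notMem_tsupport (hχ0 m z hz)],
      setIntegral_eq_integral_of_forall_compl_eq_zero fun z hz => by simp [hG, he0 m z hz]]
    refine carleman_absorb (c := c) hα0 hp (by rw [hα]; linarith) (hΦc m)
      ((hχ.hasCompactSupport m).of_isClosed_subset (isClosed_tsupport _) (hΦt m))
      (fun z hz => hposD z (hχ.tsupport_subset m (hΦt m hz))) ?_ ?_ ?_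
    · exact integrable_of_continuousAt_tsupport (hχ.hasCompactSupport m)
        (fun z hz => cG m z (hχ.tsupport_subset m hz))
        fun z hz => by simp [he, boxCommutator_eq_zero_of_notMem_tsupport hz]
    · exact fun z hz => he0 m z fun h => (hposD z h).not_ge hz
    · intro z hz
      have hzD := hχ.tsupport_subset m (hΦt m hz)
      have h1 : box (Φ m) z = χ m z * box φ z + e m z := by simp only [he, boxCommutator]; ring
      rw [h1]
      refine (abs_add_le _ _).trans ?_
      gcongr
      rw [abs_mul, abs_mul]
      calc |χ m z| * |box φ z| ≤ |χ m z| *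
            (c * min (hyp z ^ (-1 + p / 2)) (hyp z ^ (-1 - p / 2)) * |φ z|) := by
            gcongr; exact hbox z hzD
        _ = _ := by ring
  have iα := integrableOn_hyp_rpow_mul_decayWeight hn hα0 (by rw [hα]; linarith : α < β)
  have iγ := integrableOn_hyp_rpow_mul_decayWeight hn (by linarith : 0 < α + p / 2)
    (by rw [hα]; linarith : α + p / 2 < β)
  have hφsize : ∀ z, |φ z| ≤ nullSize φ z := fun z => by
    simp only [nullSize]
    exact le_add_of_nonneg_right (by positivity)
  -- The commutator bound and the decay of φ give a dominating function independent of m, while at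
  -- each point the cutoff is eventually 1 nearby, so the error there is eventually zero.
  have limG : Tendsto (fun m => ∫ z in exterior n, G m z) atTop (𝓝 (∫ z in exterior n, 0)) := by
    refine tendsto_integral_of_dominated_convergence
      (fun z => (C * K) ^ 2 * (hyp z ^ (α - 1) * ((decayWeight β z) ^ 2)⁻¹
        + hyp z ^ (α + p / 2 - 1) * ((decayWeight β z) ^ 2)⁻¹))
      (fun m => ContinuousOn.aestronglyMeasurable
        (fun z hz => (cG m z hz).continuousWithinAt) hmeas)
      ((iα.add iγ).const_mul _) (fun m => ?_) ?_
    · filter_upwards [ae_restrict_mem hmeas] with z hz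
      have hf := hposD z hz
      have hw := decayWeight_pos β z
      have hcm := hχ.commutator_le m z hz φ (hφat z hz)
      have hC : 0 ≤ C * nullSize φ z := (abs_nonneg _).trans hcm
      have hsq : (hyp z * e m z) ^ 2 ≤ (C * K) ^ 2 * ((decayWeight β z) ^ 2)⁻¹ := by
        have h2 : |C * nullSize φ z| ≤ |C| * (K * (decayWeight β z)⁻¹) := by
          rw [abs_mul, abs_of_nonneg ((abs_nonneg _).trans (hφsize z))]
          gcongr
          exact hsize z hz
        have h3 : |hyp z * e m z| ≤ |C| * (K * (decayWeight β z)⁻¹) :=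
          hcm.trans ((le_abs_self _).trans h2)
        calc (hyp z * e m z) ^ 2 = |hyp z * e m z| ^ 2 := (sq_abs _).symm
          _ ≤ (|C| * (K * (decayWeight β z)⁻¹)) ^ 2 := by gcongr
          _ = _ := by rw [mul_pow, mul_pow, sq_abs, inv_pow]; ring
      have e3 : ∀ a : ℝ, hyp z ^ (a + 1) = hyp z ^ (a - 1) * hyp z ^ 2 := fun a => by
        rw [← Real.rpow_natCast (hyp z) 2, ← Real.rpow_add hf]; norm_num; ring_nf
      have hnn : 0 ≤ G m z := by simp only [hG]; positivity
      rw [Real.norm_of_nonneg hnn]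
      calc G m z = (hyp z ^ (α - 1) + hyp z ^ (α + p / 2 - 1)) * (hyp z * e m z) ^ 2 := by
            simp only [hG, e3]; ring
        _ ≤ (hyp z ^ (α - 1) + hyp z ^ (α + p / 2 - 1))
            * ((C * K) ^ 2 * ((decayWeight β z) ^ 2)⁻¹) := by gcongr
        _ = _ := by ring
    · filter_upwards [ae_restrict_mem hmeas] with z hz
      refine tendsto_const_nhds.congr' ?_
      filter_upwards [hχ.eventually_eq_one z hz] with m hm
      simp [hG, he, boxCommutator_eq_zero_of_eq_one hm]
  have bW : ∀ z ∈ exterior n, 0 ≤ absorbWeight α p z ∧ absorbWeight α p z ≤ hyp z ^ (α - 1) := by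
    intro z hz
    have hf := hposD z hz
    refine ⟨by unfold absorbWeight; positivity, ?_⟩
    refine mul_le_of_le_one_right (by positivity) ?_
    rw [div_le_one (by positivity)]
    linarith
  set h : Spacetime n → ℝ := fun z => absorbWeight α p z * φ z ^ 2 with hh
  have ch : ContinuousOn h (exterior n) := fun z hz =>
    ((continuousAt_absorbWeight (hposD z hz) α p).mul
      ((hφat z hz).continuousAt.pow 2)).continuousWithinAt
  have hbound : ∀ z ∈ exterior n,
      h z ≤ K ^ 2 * (hyp z ^ (α - 1) * ((decayWeight β z) ^ 2)⁻¹) := by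
    intro z hz
    have hf := hposD z hz
    have h1 : φ z ^ 2 ≤ (K * (decayWeight β z)⁻¹) ^ 2 := by
      rw [← sq_abs]
      gcongr
      exact (hφsize z).trans (hsize z hz)
    calc h z ≤ hyp z ^ (α - 1) * (K * (decayWeight β z)⁻¹) ^ 2 :=
          mul_le_mul (bW z hz).2 h1 (by positivity) (by positivity)
      _ = _ := by rw [mul_pow, inv_pow]; ring
  have limH : Tendsto (fun m => ∫ z in exterior n, H m z) atTop
      (𝓝 (∫ z in exterior n, h z)) := by
    refine tendsto_integral_of_dominated_convergence
      (fun z => K ^ 2 * (hyp z ^ (α - 1) * ((decayWeight β z) ^ 2)⁻¹))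
      (fun m => ContinuousOn.aestronglyMeasurable
        (fun z hz => (cH m z hz).continuousWithinAt) hmeas)
      (iα.const_mul _) (fun m => ?_) ?_
    · filter_upwards [ae_restrict_mem hmeas] with z hz
      have hW := (bW z hz).1
      rw [Real.norm_of_nonneg (by simp only [hH]; positivity)]
      refine le_trans ?_ (hbound z hz)
      simp only [hH, hΦ, hh, mul_pow]
      gcongr
      refine mul_le_of_le_one_left (by positivity) ?_
      rw [← sq_abs]
      exact pow_le_one₀ (abs_nonneg _) (hχ.abs_le_one m z)
    · filter_upwards [ae_restrict_mem hmeas] with z hz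
      refine tendsto_const_nhds.congr' ?_
      filter_upwards [hχ.eventually_eq_one z hz] with m hm
      simp [hH, hΦ, hh, hm.self_of_nhds]
  have hle := le_of_tendsto_of_tendsto' (limH.const_mul (p ^ 2 / 8))
    (limG.const_mul (8 / α ^ 2)) key
  have hnn : 0 ≤ᵐ[volume.restrict (exterior n)] h := by
    filter_upwards [ae_restrict_mem hmeas] with z hz
    exact mul_nonneg (bW z hz).1 (sq_nonneg _)
  have hint : IntegrableOn h (exterior n) := by
    refine Integrable.mono' (iα.const_mul (K ^ 2)) (ch.aestronglyMeasurable hmeas) ?_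
    filter_upwards [ae_restrict_mem hmeas, hnn] with z hz h0
    rw [Real.norm_of_nonneg h0]
    exact hbound z hz
  have hI : ∫ z in exterior n, h z = 0 := by
    refine le_antisymm ?_ (integral_nonneg_of_ae hnn)
    rw [integral_zero, mul_zero] at hle
    exact nonpos_of_mul_nonpos_right hle (by positivity)
  have hae := (integral_eq_zero_iff_of_nonneg_ae hnn hint).1 hI
  -- Continuity on the open region upgrades almost everywhere to everywhere.
  have h0 : h z = 0 := Measure.eqOn_open_of_ae_eq hae isOpen_exterior ch continuousOn_const hz
  have hf := hposD z hz
  have hWpos : 0 < absorbWeight α p z := by unfold absorbWeight; positivity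
  exact pow_eq_zero_iff (two_ne_zero) |>.1 ((mul_eq_zero.1 h0).resolve_left hWpos.ne')

end UniqueContinuation

end ExteriorWave

end

theorem theorem1p1 :
    ∃ B : ℝ, 0 < B ∧
      ∀ (n : ℕ), 1 ≤ n →
      ∀ (β p : ℝ), 0 < p → p < β →
      ∀ (φ V : ExteriorWave.Spacetime n → ℝ),
        ContDiffOn ℝ 2 φ (ExteriorWave.exterior n) →
        ContinuousOn V (ExteriorWave.exterior n) →
        (∀ z ∈ ExteriorWave.exterior n, |ExteriorWave.box φ z| ≤ |V z| * |φ z|) →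
        ExteriorWave.Decays β φ →
        (∀ z ∈ ExteriorWave.exterior n,
          |V z| ≤ B * p * min (β - p) p *
            min (|ExteriorWave.nullU z * ExteriorWave.nullV z| ^ (-1 + p / 2))
              (|ExteriorWave.nullU z * ExteriorWave.nullV z| ^ (-1 - p / 2))) →
        ∀ z ∈ ExteriorWave.exterior n, φ z = 0 := by
  -- With c = p min(β - p, p)/64, the requirement 64|c| ≤ βp follows from min(β - p, p) ≤ p < β.
  refine ⟨1 / 64, by norm_num, fun n hn β p hp hβ φ V hφ _ hbox hdecay hV z hz => ?_⟩
  have hmin : 0 < min (β - p) p := lt_min (by linarith) hp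
  refine ExteriorWave.eq_zero_of_box_le hn (c := 1 / 64 * p * min (β - p) p) hp hβ ?_ hφ hdecay
    (fun y hy => (hbox y hy).trans ?_) hz
  · rw [abs_of_pos (by positivity)]
    nlinarith [min_le_right (β - p) p]
  · have h := hV y hy
    rw [ExteriorWave.abs_nullU_mul_nullV ((ExteriorWave.mem_exterior_iff y).1 hy)] at h
    gcongr
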